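/- Let $G$ be a simple graph (no loops or multiple edges, not necessarily connected) on a finite vertex set $V_G=\{x_1,\dots,x_n\}$. For a field $k$ let $R=k[x_1,\dots,x_n]$ with its standard grading, let $I(G)=\langle x_ax_b : \{x_a,x_b\}\in E_G\rangle\subseteq R$ be the edge ideal of $G$, and for $i,j\ge 0$ let $\beta_{i,j}(I(G))=\dim_k\operatorname{Tor}^R_i(I(G),k)_j$ be its graded Betti numbers, where $k=R/\langle x_1,\dots,x_n\rangle$. For $S\subseteq V_G$ let $G_S$ be the induced subgraph of $G$ on $S$, let $G_S^c$ be the complement of $G_S$ (a graph on the vertex set $S$), and let $\#\mathrm{comp}(G_S^c)$ be its number of connected components. Then, for every field $k$ and every $i\ge 0$, the number $\beta_{i,i+2}(I(G))$ is finite and $$\beta_{i,i+2}(I(G))=\sum_{\substack{S\subseteq V_G\\ |S|=i+2}}\bigl(\#\mathrm{comp}(G_S^c)-1\bigr).$$ In particular, the numbers $\beta_{i,i+2}(I(G))$, $i\ge 0$, do not depend on the field $k$, hence not on its characteristic. -/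

import Mathlib

open MvPolynomial
open scoped TensorProduct

attribute [local instance] MvPolynomial.gradedAlgebra

universe u v w

noncomputable section

/-- The degree `j` part of the graded free `R`-module `⨁ b, R(-deg b)`, where `R = k[x_s : s ∈ σ]`
has its standard grading and the basis vector `b` sits in degree `deg b`: the coordinate of such an
element at `b` is homogeneous of degree `j - deg b` (and is zero if `j < deg b`). -/
def freePiece {σ : Type u} {k : Type v} [Field k] {ι : Type w} (deg : ι → ℕ) (j : ℕ) :
    Submodule k (ι →₀ MvPolynomial σ k) where
  carrier := {v | ∀ b, (deg b ≤ j → (v b).IsHomogeneous (j - deg b)) ∧ (j < deg b → v b = 0)}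
  zero_mem' := fun _ => ⟨fun _ => isHomogeneous_zero _ _ _, fun _ => rfl⟩
  add_mem' := fun {v w} hv hw b =>
    ⟨fun h => ((hv b).1 h).add ((hw b).1 h), fun h => by
      rw [Finsupp.add_apply, (hv b).2 h, (hw b).2 h, add_zero]⟩
  smul_mem' := fun c v hv b =>
    ⟨fun h => (homogeneousSubmodule σ k (j - deg b)).smul_mem c ((hv b).1 h), fun h => by
      rw [Finsupp.smul_apply, (hv b).2 h, smul_zero]⟩

/-- A graded free resolution `⋯ → F₂ → F₁ → F₀ → I → 0` over `R = k[x_s : s ∈ σ]` of an ideal `I`,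
with `F i = ⨁ b : ι i, R(-deg i b)` and with maps that are `R`-linear of degree `0`. The
augmentation `ε` is written as a map to `R` with image `I`. The ranks are not required to be
finite, and the resolution is not required to be minimal. -/
structure GradedFreeResolution {σ : Type u} {k : Type v} [Field k]
    (I : Ideal (MvPolynomial σ k)) where
  ι : ℕ → Type w
  deg : ∀ i, ι i → ℕ
  d : ∀ i, (ι (i + 1) →₀ MvPolynomial σ k) →ₗ[MvPolynomial σ k] (ι i →₀ MvPolynomial σ k)
  ε : (ι 0 →₀ MvPolynomial σ k) →ₗ[MvPolynomial σ k] MvPolynomial σ k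
  d_mem : ∀ i j, ∀ v ∈ freePiece (deg (i + 1)) j, d i v ∈ freePiece (k := k) (deg i) j
  ε_mem : ∀ j, ∀ v ∈ freePiece (deg 0) j, ε v ∈ homogeneousSubmodule σ k j
  range_ε : LinearMap.range ε = I
  exact_zero : Function.Exact (d 0) ε
  exact_succ : ∀ i, Function.Exact (d (i + 1)) (d i)

/-! ### Graded Tor -/

/-- The residue field `k = R / (x_s : s ∈ σ)`, as an `R`-module. -/
abbrev ResidueModule (σ : Type u) (k : Type v) [Field k] : Type (max u v) :=
  MvPolynomial σ k ⧸ (Ideal.span (Set.range (X : σ → MvPolynomial σ k)))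

namespace GradedFreeResolution

variable {σ : Type u} {k : Type v} [Field k] {I : Ideal (MvPolynomial σ k)}

/-- The module `F i ⊗_R k`, with its structures of an `R`-module and of a `k`-module. -/
def reduction (F : GradedFreeResolution.{u, v, w} I) (i : ℕ) : Type (max u v w) :=
  (F.ι i →₀ MvPolynomial σ k) ⊗[MvPolynomial σ k] ResidueModule σ k

instance (F : GradedFreeResolution.{u, v, w} I) (i : ℕ) : AddCommGroup (F.reduction i) :=
  inferInstanceAs (AddCommGroup
    ((F.ι i →₀ MvPolynomial σ k) ⊗[MvPolynomial σ k] ResidueModule σ k))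

instance (F : GradedFreeResolution.{u, v, w} I) (i : ℕ) :
    Module (MvPolynomial σ k) (F.reduction i) :=
  inferInstanceAs (Module (MvPolynomial σ k)
    ((F.ι i →₀ MvPolynomial σ k) ⊗[MvPolynomial σ k] ResidueModule σ k))

instance (F : GradedFreeResolution.{u, v, w} I) (i : ℕ) : Module k (F.reduction i) :=
  inferInstanceAs (Module k
    ((F.ι i →₀ MvPolynomial σ k) ⊗[MvPolynomial σ k] ResidueModule σ k))

instance (F : GradedFreeResolution.{u, v, w} I) (i : ℕ) :
    IsScalarTower k (MvPolynomial σ k) (F.reduction i) :=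
  inferInstanceAs (IsScalarTower k (MvPolynomial σ k)
    ((F.ι i →₀ MvPolynomial σ k) ⊗[MvPolynomial σ k] ResidueModule σ k))

/-- The map `F i → F i ⊗_R k`, `v ↦ v ⊗ 1`. -/
def toReduction (F : GradedFreeResolution.{u, v, w} I) (i : ℕ) :
    (F.ι i →₀ MvPolynomial σ k) →ₗ[MvPolynomial σ k] F.reduction i :=
  (TensorProduct.mk (MvPolynomial σ k) (F.ι i →₀ MvPolynomial σ k) (ResidueModule σ k)).flip 1

/-- The degree `j` part of `F i ⊗_R k`: all `v ⊗ 1` with `v ∈ F i` of degree `j`. -/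
def reductionPiece (F : GradedFreeResolution.{u, v, w} I) (i j : ℕ) :
    Submodule k (F.reduction i) :=
  (freePiece (k := k) (F.deg i) j).map ((F.toReduction i).restrictScalars k)

/-- The differential `F (i + 1) ⊗_R k → F i ⊗_R k`. -/
def reductionMap (F : GradedFreeResolution.{u, v, w} I) (i : ℕ) :
    F.reduction (i + 1) →ₗ[MvPolynomial σ k] F.reduction i :=
  (F.d i).rTensor (ResidueModule σ k)

/-- The cycles of degree `j` in `F i ⊗_R k`, for the complex
`⋯ → F 1 ⊗_R k → F 0 ⊗_R k → 0`. -/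
def cycles (F : GradedFreeResolution.{u, v, w} I) : ∀ i _ : ℕ, Submodule k (F.reduction i)
  | 0, j => F.reductionPiece 0 j
  | i + 1, j => F.reductionPiece (i + 1) j ⊓ LinearMap.ker ((F.reductionMap i).restrictScalars k)

/-- The boundaries of degree `j` in `F i ⊗_R k`. -/
def boundaries (F : GradedFreeResolution.{u, v, w} I) (i j : ℕ) : Submodule k (F.reduction i) :=
  (F.reductionPiece (i + 1) j).map ((F.reductionMap i).restrictScalars k)

/-- `Tor_i^R(I, k)_j`, the degree `j` part of the `i`-th homology of `F ⊗_R k`. -/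
abbrev Tor (F : GradedFreeResolution.{u, v, w} I) (i j : ℕ) : Type (max u v w) :=
  F.cycles i j ⧸ (F.boundaries i j).submoduleOf (F.cycles i j)

end GradedFreeResolution

/-! ### The standard graded free resolution

Every homogeneous submodule `Z` of a graded module `M` is the image of the graded free module that
has one basis vector of degree `j` for each `z ∈ Z` that is homogeneous of degree `j`. Starting
from an ideal `I` and passing to the kernel again and again gives a functorial graded free
resolution of `I`. -/

namespace StandardResolution

variable {σ : Type u} {k : Type v} [Field k]

section Cover

variable {M : Type w} [AddCommGroup M] [Module k M] [Module (MvPolynomial σ k) M]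

/-- Pairs `(j, z)` with `z ∈ Z` homogeneous of degree `j`. -/
abbrev Gens (gr : ℕ → Submodule k M) (Z : Submodule (MvPolynomial σ k) M) : Type w :=
  {p : ℕ × M // p.2 ∈ Z ∧ p.2 ∈ gr p.1}

/-- The map from the free module on `Gens gr Z` to `M` that sends `(j, z)` to `z`. -/
def cover (gr : ℕ → Submodule k M) (Z : Submodule (MvPolynomial σ k) M) :
    (Gens gr Z →₀ MvPolynomial σ k) →ₗ[MvPolynomial σ k] M :=
  Finsupp.linearCombination (MvPolynomial σ k) (fun p : Gens gr Z => p.1.2)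

/-- `Z` is generated by homogeneous elements. -/
def IsGr (gr : ℕ → Submodule k M) (Z : Submodule (MvPolynomial σ k) M) : Prop :=
  Z ≤ Submodule.span (MvPolynomial σ k) {z | z ∈ Z ∧ ∃ j, z ∈ gr j}

theorem range_cover {gr : ℕ → Submodule k M} {Z : Submodule (MvPolynomial σ k) M}
    (h : IsGr gr Z) : LinearMap.range (cover gr Z) = Z := by
  rw [cover, Finsupp.range_linearCombination]
  apply le_antisymm
  · rw [Submodule.span_le]
    rintro _ ⟨p, rfl⟩
    exact p.2.1
  · refine h.trans (Submodule.span_mono ?_)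
    rintro z ⟨hz, j, hj⟩
    exact ⟨⟨(j, z), hz, hj⟩, rfl⟩

/-- The grading `gr` is compatible with the action of `R`. -/
def IsAct (σ : Type u) [Module (MvPolynomial σ k) M] (gr : ℕ → Submodule k M) : Prop :=
  ∀ (i j : ℕ) (p : MvPolynomial σ k) (m : M), p.IsHomogeneous i → m ∈ gr j → p • m ∈ gr (i + j)

theorem cover_mem {gr : ℕ → Submodule k M} (ha : IsAct σ gr)
    (Z : Submodule (MvPolynomial σ k) M) (j : ℕ) (v : Gens gr Z →₀ MvPolynomial σ k)
    (hv : v ∈ freePiece (k := k) (fun p : Gens gr Z => p.1.1) j) : cover gr Z v ∈ gr j := by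
  rw [cover, Finsupp.linearCombination_apply, Finsupp.sum]
  refine Submodule.sum_mem _ fun b _ => ?_
  rcases le_or_gt b.1.1 j with h | h
  · have := ha _ _ _ _ ((hv b).1 h) b.2.2
    rwa [Nat.sub_add_cancel h] at this
  · rw [(hv b).2 h, zero_smul]
    exact Submodule.zero_mem _

end Cover

theorem isAct_free {ι : Type w} (deg : ι → ℕ) :
    IsAct σ (freePiece (σ := σ) (k := k) deg) := by
  intro i j p m hp hm b
  constructor
  · intro h
    rw [Finsupp.smul_apply, smul_eq_mul]
    rcases le_or_gt (deg b) j with h' | h'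
    · rw [Nat.add_sub_assoc h']
      exact hp.mul ((hm b).1 h')
    · rw [(hm b).2 h', mul_zero]
      exact isHomogeneous_zero _ _ _
  · intro h
    rw [Finsupp.smul_apply, (hm b).2 (by omega), smul_zero]

theorem isAct_ring : IsAct σ (homogeneousSubmodule σ k) :=
  fun _ _ _ _ hp hm => hp.mul hm

theorem iSup_freePiece {ι : Type w} (deg : ι → ℕ) :
    ⨆ j, freePiece (σ := σ) (k := k) deg j = ⊤ := by
  rw [eq_top_iff]
  rintro v -
  induction v using Finsupp.induction_linear with
  | zero => exact Submodule.zero_mem _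
  | add f g hf hg => exact Submodule.add_mem _ hf hg
  | single b p =>
    rw [← sum_homogeneousComponent p, Finsupp.single_finsetSum]
    refine Submodule.sum_mem _ fun n _ => ?_
    refine Submodule.mem_iSup_of_mem (n + deg b) fun c => ?_
    by_cases hc : b = c
    · subst hc
      simp [homogeneousComponent_isHomogeneous]
    · simp [Finsupp.single_eq_of_ne' hc, isHomogeneous_zero]

theorem iSupIndep_freePiece {ι : Type w} (deg : ι → ℕ) :
    iSupIndep (freePiece (σ := σ) (k := k) deg) := by
  rw [iSupIndep_iff_finsetSum_eq_zero_imp_eq_zero]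
  intro s v hv h0 i hi
  ext1 b
  rw [Finsupp.zero_apply]
  rcases le_or_gt (deg b) i with h | h
  · have h1 : ∑ j ∈ s, homogeneousComponent (i - deg b) (v j b) = 0 := by
      rw [← map_sum, ← Finsupp.finsetSum_apply, h0, Finsupp.zero_apply, map_zero]
    rw [Finset.sum_eq_single_of_mem i hi] at h1
    · rwa [homogeneousComponent_eq_self ((hv i hi b).1 h)] at h1
    · intro j hj hji
      rcases le_or_gt (deg b) j with h' | h'
      · rw [homogeneousComponent_of_mem ((hv j hj b).1 h'), if_neg (by omega)]
      · rw [(hv j hj b).2 h', map_zero]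
  · exact (hv i hi b).2 h

theorem isGr_ker {ι : Type w} (deg : ι → ℕ) {M : Type*} [AddCommGroup M] [Module k M]
    [Module (MvPolynomial σ k) M] {gr : ℕ → Submodule k M}
    (hgr : iSupIndep gr) (f : (ι →₀ MvPolynomial σ k) →ₗ[MvPolynomial σ k] M)
    (hf : ∀ j, ∀ v ∈ freePiece (k := k) deg j, f v ∈ gr j) :
    IsGr (freePiece (k := k) deg) (LinearMap.ker f) := by
  intro v hv
  obtain ⟨c, hc, rfl⟩ := (Submodule.mem_iSup_iff_exists_finsupp _ v).1
    ((iSup_freePiece (k := k) deg).symm ▸ Submodule.mem_top : v ∈ ⨆ j, freePiece (k := k) deg j)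
  rw [LinearMap.mem_ker, Finsupp.sum, map_sum] at hv
  have h := (iSupIndep_iff_finsetSum_eq_zero_imp_eq_zero _).1 hgr c.support
    (fun j => f (c j)) (fun j _ => hf j _ (hc j)) hv
  exact Submodule.sum_mem _ fun j hj => Submodule.subset_span ⟨h j hj, j, hc j⟩

/-- The data carried from one step of the construction to the next: a graded free module and the
submodule of it that is to be covered next. -/
structure Step (σ : Type u) (k : Type v) [Field k] where
  ι : Type (max u v)
  deg : ι → ℕ
  Z : Submodule (MvPolynomial σ k) (ι →₀ MvPolynomial σ k)

/-- Cover the submodule `s.Z` by a graded free module, and keep the kernel. -/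
def Step.next (s : Step.{u, v} σ k) : Step.{u, v} σ k where
  ι := Gens (freePiece (k := k) s.deg) s.Z
  deg := fun p => p.1.1
  Z := LinearMap.ker (cover (freePiece (k := k) s.deg) s.Z)

/-- Cover the ideal `I` by a graded free module, and keep the kernel; then iterate. -/
def steps (I : Ideal (MvPolynomial σ k)) : ℕ → Step.{u, v} σ k
  | 0 =>
    { ι := Gens (homogeneousSubmodule σ k) I
      deg := fun p => p.1.1
      Z := LinearMap.ker (cover (homogeneousSubmodule σ k) I) }
  | i + 1 => (steps I i).next

theorem isGr_steps (I : Ideal (MvPolynomial σ k)) (i : ℕ) :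
    IsGr (freePiece (k := k) (steps I i).deg) (steps I i).Z := by
  cases i with
  | zero =>
    exact isGr_ker _ ((DirectSum.Decomposition.isInternal (homogeneousSubmodule σ k)).submodule_iSupIndep) _
      (cover_mem isAct_ring I)
  | succ i => exact isGr_ker _ (iSupIndep_freePiece _) _ (cover_mem (isAct_free _) _)

theorem exact_steps (I : Ideal (MvPolynomial σ k)) (i : ℕ) :
    Function.Exact (cover (freePiece (k := k) (steps I (i + 1)).deg) (steps I (i + 1)).Z)
      (cover (freePiece (k := k) (steps I i).deg) (steps I i).Z) :=
  LinearMap.exact_iff.2 (range_cover (isGr_steps I (i + 1))).symm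

theorem exact_steps_zero (I : Ideal (MvPolynomial σ k)) :
    Function.Exact (cover (freePiece (k := k) (steps I 0).deg) (steps I 0).Z)
      (cover (homogeneousSubmodule σ k) I) :=
  LinearMap.exact_iff.2 (range_cover (isGr_steps I 0)).symm

theorem isGr_ideal {I : Ideal (MvPolynomial σ k)} (hI : I.IsHomogeneous (homogeneousSubmodule σ k)) :
    IsGr (homogeneousSubmodule σ k) I := by
  intro p hp
  rw [← sum_homogeneousComponent p]
  exact Submodule.sum_mem _ fun n _ => Submodule.subset_span
    ⟨homogeneousComponent_mem_of_mem hI hp n, n, homogeneousComponent_isHomogeneous n p⟩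

end StandardResolution

open StandardResolution in
/-- The standard graded free resolution of a homogeneous ideal. -/
def standardResolution {σ : Type u} {k : Type v} [Field k] (I : Ideal (MvPolynomial σ k))
    (hI : I.IsHomogeneous (homogeneousSubmodule σ k)) :
    GradedFreeResolution.{u, v, max u v} I where
  ι := fun i => (steps I i).ι
  deg := fun i => (steps I i).deg
  d := fun i => cover (freePiece (k := k) (steps I i).deg) (steps I i).Z
  ε := cover (homogeneousSubmodule σ k) I
  d_mem := fun i => cover_mem (isAct_free (steps I i).deg) (steps I i).Z
  ε_mem := cover_mem isAct_ring I
  range_ε := range_cover (isGr_ideal hI)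
  exact_zero := exact_steps_zero I
  exact_succ := exact_steps I

/-- `Tor_i^R(I, k)_j` for a homogeneous ideal `I` of `R = k[x_s : s ∈ σ]`. -/
abbrev GradedTor {σ : Type u} {k : Type v} [Field k] (I : Ideal (MvPolynomial σ k))
    (hI : I.IsHomogeneous (homogeneousSubmodule σ k)) (i j : ℕ) : Type (max u v) :=
  (standardResolution I hI).Tor i j

/-- The graded Betti number `β_{i,j}(I) = dim_k Tor_i^R(I, k)_j` of a homogeneous ideal. -/
def gradedBetti {σ : Type u} {k : Type v} [Field k] (I : Ideal (MvPolynomial σ k))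
    (hI : I.IsHomogeneous (homogeneousSubmodule σ k)) (i j : ℕ) : ℕ :=
  Module.finrank k (GradedTor I hI i j)

/-! ### Edge ideals -/

/-- The edge ideal of `G` in the polynomial ring with one variable for each vertex, generated by
the products `x_s x_t` with `s` and `t` adjacent. -/
def edgeIdeal (k : Type v) [Field k] {V : Type u} (G : SimpleGraph V) :
    Ideal (MvPolynomial V k) :=
  Ideal.span {p | ∃ s t, G.Adj s t ∧ p = X s * X t}

theorem edgeIdeal_isHomogeneous (k : Type v) [Field k] {V : Type u} (G : SimpleGraph V) :
    (edgeIdeal k G).IsHomogeneous (homogeneousSubmodule V k) := by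
  refine Ideal.homogeneous_span _ _ ?_
  rintro _ ⟨s, t, -, rfl⟩
  exact ⟨1 + 1, (isHomogeneous_X k s).mul (isHomogeneous_X k t)⟩

/-- The number of connected components of the complement of the induced subgraph of `G` on `S`. -/
def numCompCompl {V : Type u} (G : SimpleGraph V) (S : Finset V) : ℕ :=
  Nat.card ((G.induce (S : Set V))ᶜ).ConnectedComponent

end

/-! Tor is computed from the other side, with the Koszul complex of the variables instead of a
resolution of `I`: `Tor_i(I,k)` in degree `q+i+1` is the Koszul homology at `Λ^i ⊗ I_{q+1}`
(`nonempty_tor_equiv`). The comparison is dimension shifting along the resolution, which works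
because the Koszul complex of a graded free module is acyclic in positive exterior degree
(`exists_koszulD_eq`).

In degree `i+2` the relevant term is `Λ^i ⊗ I_2`. Since `I_1 = 0` there are no boundaries, so Tor is
the space of cycles. Acyclicity over `R` writes such a cycle as `∂w` with `w ∈ Λ^{i+1} ⊗ R_1`, and
`∂w` has coefficients in `I` exactly when the coefficients of all `x_a²`, and of all `x_a x_b` with
`a`, `b` not adjacent, vanish. The squares force `w` to be given by scalars `g(S,b)` with `|S| =
i+2` and `b ∈ S` (`linearChain`). The coefficient of `x_a x_b` at `U` is then `±(g(S,b) - g(S,a))`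
for `S = U ∪ {a,b}`, so `g(S,·)` must be constant on the components of the complement of `G_S`
(`range_componentSyzygy`). Moreover `∂w = 0` exactly when each `g(S,·)` is constant on `S`
(`ker_componentSyzygy`). Each `S` thus contributes its number of components minus one, over any
field. -/

noncomputable section

/-! ### The Koszul complex of commuting operators and its acyclicity -/

section Koszul

/-- Cancelling terms in pairs, with the diagonal treated separately, avoids a division by 2 and so
is valid in characteristic 2. -/
theorem sum_sum_eq_zero_of_swap {V : Type*} [Fintype V] {A : Type*} [AddCommGroup A] {t : V → V → A}
    (h0 : ∀ a, t a a = 0) (h : ∀ a b, a ≠ b → t a b + t b a = 0) : ∑ a, ∑ b, t a b = 0 := by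
  rw [← Finset.sum_product']
  refine Finset.sum_involution (fun p _ => p.swap) ?_ ?_ (by simp) (by simp)
  · rintro ⟨a, b⟩ -
    by_cases hab : a = b
    · subst hab
      simp [h0]
    · exact h a b hab
  · rintro ⟨a, b⟩ - h h'
    obtain rfl : b = a := congrArg Prod.fst h'
    exact h (h0 b)

variable {V : Type u} [LinearOrder V] {k : Type v} [Field k]
  {M : Type w} [AddCommGroup M] [Module k M]

/-- The sign of moving `a` past the elements of `T` that are smaller than `a`. -/
def koszulSign (a : V) (T : Finset V) : ℤ := ∏ b ∈ T, if b < a then -1 else 1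

theorem koszulSign_insert {a b : V} {T : Finset V} (h : b ∉ T) :
    koszulSign a (insert b T) = (if b < a then -1 else 1) * koszulSign a T :=
  Finset.prod_insert h

theorem koszulSign_insert_self {a : V} {T : Finset V} (h : a ∉ T) :
    koszulSign a (insert a T) = koszulSign a T := by
  simp [koszulSign_insert h]

theorem koszulSign_erase_self (a : V) (T : Finset V) :
    koszulSign a (T.erase a) = koszulSign a T := by
  by_cases h : a ∈ T
  · conv_rhs => rw [← Finset.insert_erase h]
    rw [koszulSign_insert_self (Finset.notMem_erase a T)]
  · rw [Finset.erase_eq_of_notMem h]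

theorem koszulSign_mul_self (a : V) (T : Finset V) : koszulSign a T * koszulSign a T = 1 := by
  rw [koszulSign, ← Finset.prod_mul_distrib]
  exact Finset.prod_eq_one fun b _ => by split_ifs <;> simp

theorem koszulSign_swap {a b : V} {T : Finset V} (hab : a ≠ b) (ha : a ∉ T) (hb : b ∉ T) :
    koszulSign a T * koszulSign b (insert a T) = -(koszulSign b T * koszulSign a (insert b T)) := by
  rw [koszulSign_insert ha, koszulSign_insert hb]
  rcases lt_or_gt_of_ne hab with h | h
  · simp [h, h.not_gt]; ring
  · simp [h, h.not_gt]; ring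

/-- This is `koszulSign_swap` for `T.erase a`, multiplied by the signs of `b` with respect to `T`
and `T.erase a`, both of which square to 1. -/
theorem koszulSign_swap_erase {a b : V} {T : Finset V} (hab : a ≠ b) (ha : a ∈ T) (hb : b ∉ T) :
    koszulSign b T * koszulSign a (insert b T) =
      -(koszulSign a T * koszulSign b (T.erase a)) := by
  have h := koszulSign_swap hab (Finset.notMem_erase a T) (fun h => hb (Finset.mem_of_mem_erase h))
  rw [Finset.insert_erase ha, koszulSign_erase_self] at h
  have h2 : koszulSign a (insert b T) = koszulSign a (insert b (T.erase a)) := by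
    rw [← koszulSign_erase_self a (insert b T), Finset.erase_insert_of_ne hab.symm]
  have e2 := koszulSign_mul_self b (T.erase a)
  have e3 := koszulSign_mul_self b T
  rw [h2]
  linear_combination koszulSign b T * koszulSign b (T.erase a) * h -
    koszulSign a T * koszulSign b (T.erase a) * e3 -
    koszulSign b T * koszulSign a (insert b (T.erase a)) * e2

/-- Contraction with the basis vector `a`, combined with the operator `x`. -/
def contract (x : Module.End k M) (a : V) : Module.End k (Finset V → M) where
  toFun z T := if a ∈ T then 0 else koszulSign a T • x (z (insert a T))
  map_add' z w := by
    ext T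
    by_cases h : a ∈ T <;> simp [h]
  map_smul' c z := by
    ext T
    by_cases h : a ∈ T <;> simp [h, smul_comm c]

/-- Exterior multiplication by the basis vector `a`, combined with the operator `y`. -/
def wedge (y : Module.End k M) (a : V) : Module.End k (Finset V → M) where
  toFun z T := if a ∈ T then koszulSign a T • y (z (T.erase a)) else 0
  map_add' z w := by
    ext T
    by_cases h : a ∈ T <;> simp [h]
  map_smul' c z := by
    ext T
    by_cases h : a ∈ T <;> simp [h, smul_comm c]

theorem contract_apply (x : Module.End k M) (a : V) (z : Finset V → M) (T : Finset V) :
    contract x a z T = if a ∈ T then 0 else koszulSign a T • x (z (insert a T)) := rfl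

theorem wedge_apply (y : Module.End k M) (a : V) (z : Finset V → M) (T : Finset V) :
    wedge y a z T = if a ∈ T then koszulSign a T • y (z (T.erase a)) else 0 := rfl

theorem contract_contract_self (x y : Module.End k M) (a : V) (z : Finset V → M) :
    contract x a (contract y a z) = 0 := by
  ext T
  simp [contract_apply]

theorem contract_contract {x y : Module.End k M} (h : Commute x y) {a b : V} (hab : a ≠ b)
    (z : Finset V → M) :
    contract x a (contract y b z) + contract y b (contract x a z) = 0 := by
  ext T
  by_cases ha : a ∈ T
  · simp [contract_apply, ha]
  by_cases hb : b ∈ T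
  · simp [contract_apply, hb]
  have hxy : ∀ m, x (y m) = y (x m) := fun m => LinearMap.congr_fun h m
  simp only [Pi.add_apply, contract_apply, ha, hb, if_false, Finset.mem_insert, hab, hab.symm,
    or_self, map_zsmul, smul_smul, Pi.zero_apply, hxy, Finset.insert_comm b a]
  rw [koszulSign_swap hab ha hb, neg_smul, neg_add_cancel]

theorem contract_wedge {x y : Module.End k M} (h : Commute x y) {a b : V} (hab : a ≠ b)
    (z : Finset V → M) :
    contract x b (wedge y a z) + wedge y a (contract x b z) = 0 := by
  ext T
  by_cases ha : a ∈ T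
  swap
  · simp [contract_apply, wedge_apply, ha, hab]
  by_cases hb : b ∈ T
  · simp [contract_apply, wedge_apply, hb, hab.symm]
  have hxy : ∀ m, x (y m) = y (x m) := fun m => LinearMap.congr_fun h m
  simp only [Pi.add_apply, contract_apply, wedge_apply, ha, hb, if_false, Finset.mem_insert,
    if_true, or_true, Finset.mem_erase, and_false, map_zsmul, smul_smul, Pi.zero_apply, hxy,
    Finset.erase_insert_of_ne hab.symm]
  rw [koszulSign_swap_erase hab ha hb, neg_smul, neg_add_cancel]

/-- For equal indices only one of the two terms survives at each `T`, and its sign occurs squared.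
-/
theorem contract_wedge_self (x y : Module.End k M) (a : V) (z : Finset V → M) (T : Finset V) :
    contract x a (wedge y a z) T + wedge y a (contract x a z) T =
      if a ∈ T then y (x (z T)) else x (y (z T)) := by
  by_cases ha : a ∈ T
  · simp [contract_apply, wedge_apply, ha, smul_smul, koszulSign_erase_self, koszulSign_mul_self]
  · simp [contract_apply, wedge_apply, ha, smul_smul, koszulSign_insert_self, koszulSign_mul_self]

/-- Chains of the Koszul complex of exterior degree `p` with coefficients in `W`. -/
def koszulChains (V : Type u) (p : ℕ) (W : Submodule k M) : Submodule k (Finset V → M) where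
  carrier := {z | ∀ T : Finset V, (T.card = p → z T ∈ W) ∧ (T.card ≠ p → z T = 0)}
  zero_mem' := fun _ => ⟨fun _ => W.zero_mem, fun _ => rfl⟩
  add_mem' := fun {z w} hz hw T => ⟨fun h => W.add_mem ((hz T).1 h) ((hw T).1 h), fun h => by
    rw [Pi.add_apply, (hz T).2 h, (hw T).2 h, add_zero]⟩
  smul_mem' := fun c z hz T => ⟨fun h => W.smul_mem c ((hz T).1 h), fun h => by
    rw [Pi.smul_apply, (hz T).2 h, smul_zero]⟩

theorem contract_mem {x : Module.End k M} {W W' : Submodule k M} (hx : ∀ m ∈ W, x m ∈ W') (a : V)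
    {p : ℕ} {z : Finset V → M} (hz : z ∈ koszulChains V (p + 1) W) :
    contract x a z ∈ koszulChains V p W' := by
  intro T
  by_cases ha : a ∈ T
  · simp [contract_apply, ha]
  have hc := Finset.card_insert_of_notMem ha
  constructor
  · intro h
    simp only [contract_apply, ha, if_false]
    exact zsmul_mem (hx _ ((hz _).1 (by omega))) _
  · intro h
    simp only [contract_apply, ha, if_false]
    rw [(hz _).2 (by omega), map_zero, smul_zero]

theorem wedge_mem {y : Module.End k M} {W W' : Submodule k M} (hy : ∀ m ∈ W, y m ∈ W') (a : V)
    {p : ℕ} {z : Finset V → M} (hz : z ∈ koszulChains V p W) :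
    wedge y a z ∈ koszulChains V (p + 1) W' := by
  intro T
  by_cases ha : a ∈ T
  swap
  · simp [wedge_apply, ha]
  have hc := Finset.card_erase_add_one ha
  constructor
  · intro h
    simp only [wedge_apply, ha, if_true]
    exact zsmul_mem (hy _ ((hz _).1 (by omega))) _
  · intro h
    simp only [wedge_apply, ha, if_true]
    rw [(hz _).2 (by omega), map_zero, smul_zero]

variable [Fintype V]

/-- The Koszul differential of a family of operators. -/
def koszulD (x : V → Module.End k M) : Module.End k (Finset V → M) := ∑ a, contract (x a) a

theorem koszulD_apply (x : V → Module.End k M) (z : Finset V → M) :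
    koszulD x z = ∑ a, contract (x a) a z := by
  simp [koszulD]

theorem koszulD_apply_apply (x : V → Module.End k M) (z : Finset V → M) (T : Finset V) :
    koszulD x z T = ∑ a, if a ∈ T then 0 else koszulSign a T • x a (z (insert a T)) := by
  simp [koszulD_apply, contract_apply]

theorem koszulD_koszulD {x : V → Module.End k M} (hx : ∀ a b, Commute (x a) (x b))
    (z : Finset V → M) : koszulD x (koszulD x z) = 0 := by
  simp only [koszulD_apply, map_sum]
  exact sum_sum_eq_zero_of_swap (fun a => contract_contract_self _ _ _ _)
    fun a b hab => contract_contract (hx b a) hab.symm z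

theorem koszulD_mem {x : V → Module.End k M} {W W' : Submodule k M}
    (hx : ∀ a, ∀ m ∈ W, x a m ∈ W') {p : ℕ} {z : Finset V → M}
    (hz : z ∈ koszulChains V (p + 1) W) : koszulD x z ∈ koszulChains V p W' := by
  rw [koszulD_apply]
  exact Submodule.sum_mem _ fun a _ => contract_mem (hx a) a hz

theorem koszulD_eq_zero (x : V → Module.End k M) {W : Submodule k M} {z : Finset V → M}
    (hz : z ∈ koszulChains V 0 W) : koszulD x z = 0 := by
  ext T
  rw [koszulD_apply_apply]
  refine Finset.sum_eq_zero fun a _ => ?_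
  split_ifs with h
  · rfl
  · rw [(hz (insert a T)).2 (by simp [h]), map_zero, smul_zero]

/-- A homotopy in the single direction `a`: the terms with `b ≠ a` cancel by `contract_wedge`, which
leaves `contract_wedge_self`. -/
theorem koszulD_wedge {x y : V → Module.End k M} (hyx : ∀ a, y a * x a = 1)
    (hxy : ∀ a b, a ≠ b → Commute (x b) (y a)) (a : V) (z : Finset V → M) (T : Finset V) :
    koszulD x (wedge (y a) a z) T + wedge (y a) a (koszulD x z) T =
      if a ∈ T then z T else x a (y a (z T)) := by
  have h : ∀ m, y a (x a m) = m := fun m => LinearMap.congr_fun (hyx a) m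
  have := contract_wedge_self (x a) (y a) a z T
  rw [h] at this
  rw [← this, ← Pi.add_apply, ← Pi.add_apply, koszulD_apply, koszulD_apply, map_sum,
    ← Finset.sum_add_distrib, Finset.sum_eq_single_of_mem a (Finset.mem_univ a)]
  intro b _ hb
  exact contract_wedge (hxy a b hb.symm) hb.symm z

/-- Every cycle is homologous to one that is concentrated in exterior degree `0` and killed by all
the operators `y a`. -/
theorem exists_koszulD_add {x y : V → Module.End k M} (hx : ∀ a b, Commute (x a) (x b))
    (hyx : ∀ a, y a * x a = 1) (hxy : ∀ a b, a ≠ b → Commute (x b) (y a))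
    (hy : ∀ a b, Commute (y a) (y b)) {W W' : Submodule k M} (hW : ∀ a, ∀ m ∈ W, x a m ∈ W')
    (hW' : ∀ a, ∀ m ∈ W', y a m ∈ W) {p : ℕ} {z : Finset V → M}
    (hz : z ∈ koszulChains V p W') (hdz : koszulD x z = 0) (s : Finset V) :
    ∃ w ∈ koszulChains V (p + 1) W, ∃ z' ∈ koszulChains V p W', z = koszulD x w + z' ∧
      ∀ a ∈ s, ∀ T, (a ∈ T → z' T = 0) ∧ y a (z' T) = 0 := by
  induction s using Finset.induction_on with
  | empty => exact ⟨0, Submodule.zero_mem _, z, hz, by simp, by simp⟩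
  | insert b s hb ih =>
    obtain ⟨w, hw, z', hz', rfl, h⟩ := ih
    rw [map_add, koszulD_koszulD hx, zero_add] at hdz
    have hw' : wedge (y b) b z' ∈ koszulChains V (p + 1) W := wedge_mem (hW' b) b hz'
    -- Since `z'` is a cycle, subtracting the boundary of its homotopy erases the components at `T ∋
    -- b` and replaces the others by their remainder `(1 - x b * y b)`, which `y b` kills. What was
    -- achieved for earlier indices persists because operators with distinct indices commute.
    have key : ∀ T, (z' - koszulD x (wedge (y b) b z')) T =
        if b ∈ T then 0 else z' T - x b (y b (z' T)) := by
      intro T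
      have := koszulD_wedge hyx hxy b z' T
      rw [hdz, map_zero, Pi.zero_apply, add_zero] at this
      rw [Pi.sub_apply, this]
      split_ifs <;> simp
    refine ⟨w + wedge (y b) b z', Submodule.add_mem _ hw hw', z' - koszulD x (wedge (y b) b z'),
      Submodule.sub_mem _ hz' (koszulD_mem hW hw'), by rw [map_add]; abel, ?_⟩
    intro a ha T
    rw [key]
    by_cases hbT : b ∈ T
    · simp [hbT]
    rw [if_neg hbT]
    have hyxb : ∀ m, y b (x b m) = m := fun m => LinearMap.congr_fun (hyx b) m
    rcases Finset.mem_insert.1 ha with rfl | ha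
    · exact ⟨fun h => absurd h hbT, by rw [map_sub, hyxb, sub_self]⟩
    · have hab : a ≠ b := fun h => hb (h ▸ ha)
      refine ⟨fun haT => by rw [(h a ha T).1 haT]; simp, ?_⟩
      have e1 : y a (x b (y b (z' T))) = x b (y a (y b (z' T))) :=
        (LinearMap.congr_fun (hxy a b hab) _).symm
      have e2 : y a (y b (z' T)) = y b (y a (z' T)) := LinearMap.congr_fun (hy a b) _
      rw [map_sub, e1, e2, (h a ha T).2]
      simp

/-- Acyclicity of the Koszul complex in positive exterior degree. In exterior degree `0`, the
obstruction is detected by `c`. -/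
theorem exists_koszulD_eq {x y : V → Module.End k M} (hx : ∀ a b, Commute (x a) (x b))
    (hyx : ∀ a, y a * x a = 1) (hxy : ∀ a b, a ≠ b → Commute (x b) (y a))
    (hy : ∀ a b, Commute (y a) (y b)) {W W' : Submodule k M} (hW : ∀ a, ∀ m ∈ W, x a m ∈ W')
    (hW' : ∀ a, ∀ m ∈ W', y a m ∈ W) {N : Type*} [AddCommGroup N] [Module k N] (c : M →ₗ[k] N)
    (hcx : ∀ a m, c (x a m) = 0) (hc : ∀ m, (∀ a, y a m = 0) → c m = 0 → m = 0)
    {p : ℕ} {z : Finset V → M}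
    (hz : z ∈ koszulChains V p W') (hdz : koszulD x z = 0) (h0 : p = 0 → c (z ∅) = 0) :
    ∃ w ∈ koszulChains V (p + 1) W, koszulD x w = z := by
  obtain ⟨w, hw, z', hz', rfl, h⟩ := exists_koszulD_add hx hyx hxy hy hW hW' hz hdz Finset.univ
  refine ⟨w, hw, ?_⟩
  suffices z' = 0 by rw [this, add_zero]
  ext T
  -- Only the component at `∅` can survive, and all `y a` kill it; boundaries do not contribute to
  -- its image under `c`.
  rcases T.eq_empty_or_nonempty with rfl | ⟨a, ha⟩
  · by_cases hp : p = 0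
    · refine hc _ (fun a => (h a (Finset.mem_univ a) ∅).2) ?_
      have := h0 hp
      rw [Pi.add_apply, map_add, koszulD_apply_apply, map_sum, Finset.sum_eq_zero, zero_add] at this
      · exact this
      · intro a _
        simp [hcx]
    · exact (hz' ∅).2 (by simpa using Ne.symm hp)
  · exact (h a (Finset.mem_univ a) T).1 ha

end Koszul

/-! ### Comparison of subquotients -/

section Subquotient

variable {k : Type v} [Field k] {X Y Z : Type*} [AddCommGroup X] [Module k X]
  [AddCommGroup Y] [Module k Y] [AddCommGroup Z] [Module k Z]

/-- Two subquotients that are images of the same submodule `A`, in such a way that the same elements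
of `A` become zero, are isomorphic. -/
theorem nonempty_subquotient_equiv {f : X →ₗ[k] Y} {g : X →ₗ[k] Z} {A : Submodule k X}
    {C B : Submodule k Y} {C' B' : Submodule k Z} (hf : A.map f = C) (hg : A.map g = C')
    (h : ∀ a ∈ A, f a ∈ B ↔ g a ∈ B') :
    Nonempty ((C ⧸ B.submoduleOf C) ≃ₗ[k] (C' ⧸ B'.submoduleOf C')) := by
  subst hf hg
  have hf' := (Submodule.mkQ_surjective (B.submoduleOf (A.map f))).comp
    (f.submoduleMap_surjective A)
  have hg' := (Submodule.mkQ_surjective (B'.submoduleOf (A.map g))).comp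
    (g.submoduleMap_surjective A)
  refine ⟨(((Submodule.mkQ _).comp (f.submoduleMap A)).quotKerEquivOfSurjective hf').symm ≪≫ₗ
    Submodule.quotEquivOfEq _ _ ?_ ≪≫ₗ
    ((Submodule.mkQ _).comp (g.submoduleMap A)).quotKerEquivOfSurjective hg'⟩
  refine Submodule.ext fun a => ?_
  have h1 := Submodule.Quotient.mk_eq_zero (B.submoduleOf (A.map f)) (x := f.submoduleMap A a)
  have h2 := Submodule.Quotient.mk_eq_zero (B'.submoduleOf (A.map g)) (x := g.submoduleMap A a)
  exact h1.trans ((h a a.2).trans h2.symm)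

theorem nonempty_quotient_bot_equiv (C : Submodule k Y) :
    Nonempty ((C ⧸ (⊥ : Submodule k Y).submoduleOf C) ≃ₗ[k] C) := by
  have h : (⊥ : Submodule k Y).submoduleOf C = ⊥ := by
    ext c
    simp [Submodule.submoduleOf]
  exact ⟨Submodule.quotEquivOfEqBot _ h⟩

end Subquotient

/-! ### Koszul chains under a change of coefficients -/

section Chains

variable {V : Type u} {k : Type v} [Field k]
  {M : Type*} [AddCommGroup M] [Module k M] {N : Type*} [AddCommGroup N] [Module k N]

theorem map_koszulChains (f : M →ₗ[k] N) (p : ℕ) (W : Submodule k M) :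
    (koszulChains V p W).map (f.compLeft (Finset V)) = koszulChains V p (W.map f) := by
  ext z
  constructor
  · rintro ⟨w, hw, rfl⟩ T
    refine ⟨fun h => ⟨_, (hw T).1 h, rfl⟩, fun h => ?_⟩
    rw [LinearMap.compLeft_apply, Function.comp_apply, (hw T).2 h, map_zero]
  · intro hz
    have h : ∀ T : Finset V, ∃ m, (T.card = p → m ∈ W) ∧ (T.card ≠ p → m = 0) ∧ f m = z T := by
      intro T
      by_cases hT : T.card = p
      · obtain ⟨m, hm, h⟩ := (hz T).1 hT
        exact ⟨m, fun _ => hm, fun h => absurd hT h, h⟩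
      · exact ⟨0, fun h => absurd h hT, fun _ => rfl, by rw [(hz T).2 hT, map_zero]⟩
    choose w h1 h2 h3 using h
    exact ⟨w, fun T => ⟨h1 T, h2 T⟩, funext h3⟩

theorem mem_koszulChains_ker {f : M →ₗ[k] N} {p : ℕ} {W : Submodule k M} {z : Finset V → M} :
    z ∈ koszulChains V p (LinearMap.ker f ⊓ W) ↔
      z ∈ koszulChains V p W ∧ f.compLeft (Finset V) z = 0 := by
  constructor
  · intro h
    refine ⟨fun T => ⟨fun hT => ((h T).1 hT).2, (h T).2⟩, ?_⟩
    ext T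
    by_cases hT : T.card = p
    · exact ((h T).1 hT).1
    · rw [LinearMap.compLeft_apply, Function.comp_apply, (h T).2 hT, map_zero, Pi.zero_apply]
  · rintro ⟨h, h0⟩ T
    exact ⟨fun hT => ⟨congrFun h0 T, (h T).1 hT⟩, (h T).2⟩

end Chains

/-! ### Dimension shifting in Koszul homology -/

section Shift

variable {V : Type u} [LinearOrder V] [Fintype V] {k : Type v} [Field k]
  {M : Type*} [AddCommGroup M] [Module k M] {N : Type*} [AddCommGroup N] [Module k N]

/-- Koszul homology in exterior degree `p` and internal degree `q + 1` of a graded module with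
graded pieces `W`. -/
abbrev KoszulHomology (x : V → Module.End k M) (W : ℕ → Submodule k M) (p q : ℕ) : Type _ :=
  (koszulChains V p (W (q + 1)) ⊓ LinearMap.ker (koszulD x) : Submodule k (Finset V → M)) ⧸
    ((koszulChains V (p + 1) (W q)).map (koszulD x)).submoduleOf
      (koszulChains V p (W (q + 1)) ⊓ LinearMap.ker (koszulD x))

theorem koszulD_compLeft {x : V → Module.End k M} {x' : V → Module.End k N} {f : M →ₗ[k] N}
    (hf : ∀ a m, f (x a m) = x' a (f m)) (z : Finset V → M) :
    koszulD x' (f.compLeft (Finset V) z) = f.compLeft (Finset V) (koszulD x z) := by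
  ext T
  simp only [koszulD_apply_apply, LinearMap.compLeft_apply, Function.comp_apply, map_sum]
  refine Finset.sum_congr rfl fun a _ => ?_
  split_ifs <;> simp [hf]

/-- Dimension shifting: `Z = ker f` and the image of `f`, for `f` defined on a graded module `W`
whose Koszul complex is acyclic. -/
theorem nonempty_shift_equiv {x : V → Module.End k M} {x' : V → Module.End k N}
    (hx : ∀ a b, Commute (x a) (x b)) {f : M →ₗ[k] N} (hf : ∀ a m, f (x a m) = x' a (f m))
    {W : ℕ → Submodule k M} (hW : ∀ q a, ∀ m ∈ W q, x a m ∈ W (q + 1))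
    (hac : ∀ p q, ∀ z ∈ koszulChains V (p + 1) (W (q + 1)), koszulD x z = 0 →
      ∃ w ∈ koszulChains V (p + 2) (W q), koszulD x w = z)
    {Z : ℕ → Submodule k M} (hZ : ∀ q, Z q = LinearMap.ker f ⊓ W q) (p q : ℕ) :
    Nonempty (KoszulHomology x' (fun q => (W q).map f) (p + 1) q ≃ₗ[k]
      ((koszulChains V p (Z (q + 2)) ⊓
        (koszulChains V (p + 1) (W (q + 1))).map (koszulD x) : Submodule k (Finset V → M)) ⧸
      ((koszulChains V (p + 1) (Z (q + 1))).map (koszulD x)).submoduleOf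
        (koszulChains V p (Z (q + 2)) ⊓
        (koszulChains V (p + 1) (W (q + 1))).map (koszulD x)))) := by
  obtain rfl : Z = fun q => LinearMap.ker f ⊓ W q := funext hZ
  have hdf := koszulD_compLeft (V := V) hf
  -- The connecting map as a correspondence: `A` consists of the chains `w` with `f (∂w) = 0`, and
  -- `f w` corresponds to `∂w`. No lift has to be chosen.
  refine nonempty_subquotient_equiv (f := f.compLeft (Finset V)) (g := koszulD x)
    (A := koszulChains V (p + 1) (W (q + 1)) ⊓
      LinearMap.ker ((f.compLeft (Finset V)).comp (koszulD x))) ?_ ?_ ?_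
  · rw [← map_koszulChains]
    ext z
    constructor
    · rintro ⟨w, ⟨hw, hw'⟩, rfl⟩
      exact ⟨⟨w, hw, rfl⟩, (hdf w).trans hw'⟩
    · rintro ⟨⟨w, hw, rfl⟩, hw'⟩
      exact ⟨w, ⟨hw, (hdf w).symm.trans hw'⟩, rfl⟩
  · ext z
    constructor
    · rintro ⟨w, ⟨hw, hw'⟩, rfl⟩
      exact ⟨mem_koszulChains_ker.2 ⟨koszulD_mem (hW (q + 1)) hw, hw'⟩, w, hw, rfl⟩
    · rintro ⟨hz, w, hw, rfl⟩
      exact ⟨w, ⟨hw, (mem_koszulChains_ker.1 hz).2⟩, rfl⟩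
  -- If `f w = ∂ (f w')`, then `w - ∂w'` lies in `Z` and has the same boundary as `w`. Conversely,
  -- if `∂w = ∂w'` with `w'` in `Z`, acyclicity makes `w - w'` a boundary, and `f` sends it to `f
  -- w`.
  · rintro w ⟨hw, -⟩
    rw [← map_koszulChains]
    constructor
    · rintro ⟨_, ⟨w', hw', rfl⟩, h⟩
      rw [hdf] at h
      refine ⟨w - koszulD x w', mem_koszulChains_ker.2
        ⟨Submodule.sub_mem _ hw (koszulD_mem (hW q) hw'), ?_⟩, ?_⟩
      · rw [map_sub, h, sub_self]
      · rw [map_sub, koszulD_koszulD hx, sub_zero]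
    · rintro ⟨w', hw', h⟩
      obtain ⟨hw1, hw2⟩ := mem_koszulChains_ker.1 hw'
      obtain ⟨w'', hw'', h2⟩ := hac p q (w - w') (Submodule.sub_mem _ hw hw1)
        (by rw [map_sub, h, sub_self])
      refine ⟨f.compLeft (Finset V) w'', ⟨w'', hw'', rfl⟩, ?_⟩
      rw [hdf, h2, map_sub, hw2, sub_zero]

/-- In positive exterior degree the cycles over `W` are boundaries, so the intersection in
`nonempty_shift_equiv` is the full space of cycles with coefficients in `Z`. -/
theorem nonempty_koszulHomology_shift {x : V → Module.End k M} {x' : V → Module.End k N}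
    (hx : ∀ a b, Commute (x a) (x b)) {f : M →ₗ[k] N} (hf : ∀ a m, f (x a m) = x' a (f m))
    {W : ℕ → Submodule k M} (hW : ∀ q a, ∀ m ∈ W q, x a m ∈ W (q + 1))
    (hac : ∀ p q, ∀ z ∈ koszulChains V (p + 1) (W (q + 1)), koszulD x z = 0 →
      ∃ w ∈ koszulChains V (p + 2) (W q), koszulD x w = z)
    {Z : ℕ → Submodule k M} (hZ : ∀ q, Z q = LinearMap.ker f ⊓ W q) (p q : ℕ) :
    Nonempty (KoszulHomology x' (fun q => (W q).map f) (p + 2) q ≃ₗ[k]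
      KoszulHomology x Z (p + 1) (q + 1)) := by
  have h := nonempty_shift_equiv hx hf hW hac hZ (p + 1) q
  have e : koszulChains V (p + 1) (Z (q + 2)) ⊓
      (koszulChains V (p + 1 + 1) (W (q + 1))).map (koszulD x) =
      koszulChains V (p + 1) (Z (q + 2)) ⊓ LinearMap.ker (koszulD x) := by
    ext z
    rw [hZ]
    constructor
    · rintro ⟨hz, w, hw, rfl⟩
      exact ⟨hz, koszulD_koszulD hx w⟩
    · rintro ⟨hz, h0⟩
      exact ⟨hz, hac p (q + 1) z (mem_koszulChains_ker.1 hz).1 h0⟩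
  rw [e] at h
  exact h

end Shift

/-! ### Acyclicity for the polynomial ring and for graded free modules -/

section FreeModule

variable {V : Type u} {k : Type v} [Field k]

/-- Multiplication by the variable `a`, as a `k`-linear map. -/
def varMul (k : Type v) [Field k] (M : Type*) [AddCommGroup M] [Module k M]
    [Module (MvPolynomial V k) M] [IsScalarTower k (MvPolynomial V k) M] (a : V) :
    Module.End k M :=
  Algebra.lsmul k k M (X a : MvPolynomial V k)

theorem varMul_apply {M : Type*} [AddCommGroup M] [Module k M]
    [Module (MvPolynomial V k) M] [IsScalarTower k (MvPolynomial V k) M] (a : V) (m : M) :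
    varMul k M a m = (X a : MvPolynomial V k) • m := rfl

theorem commute_varMul {M : Type*} [AddCommGroup M] [Module k M]
    [Module (MvPolynomial V k) M] [IsScalarTower k (MvPolynomial V k) M] (a b : V) :
    Commute (varMul k M a) (varMul k M b) := by
  ext m
  exact smul_comm (X a : MvPolynomial V k) (X b : MvPolynomial V k) m

/-- Division by the variable `a`, discarding the remainder. -/
def varDiv (k : Type v) [Field k] (a : V) : Module.End k (MvPolynomial V k) where
  toFun p := p.divMonomial (Finsupp.single a 1)
  map_add' p q := add_divMonomial p q _
  map_smul' c p := by
    ext m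
    simp [coeff_divMonomial]

theorem coeff_varDiv (a : V) (p : MvPolynomial V k) (m : V →₀ ℕ) :
    coeff m (varDiv k a p) = coeff (Finsupp.single a 1 + m) p :=
  coeff_divMonomial _ _ _

theorem varDiv_X_mul_self (a : V) (p : MvPolynomial V k) : varDiv k a (X a * p) = p :=
  X_mul_divMonomial a p

theorem varDiv_X_mul {a b : V} (hab : a ≠ b) (p : MvPolynomial V k) :
    varDiv k a (X b * p) = X b * varDiv k a p := by
  classical
  ext m
  have h : (Finsupp.single a 1 + m : V →₀ ℕ) b = m b := by simp [hab]
  rw [coeff_varDiv, coeff_X_mul', coeff_X_mul', coeff_varDiv]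
  simp only [Finsupp.mem_support_iff, h]
  split_ifs with hb
  · rw [add_tsub_assoc_of_le]
    rw [Finsupp.single_le_iff]
    exact Nat.one_le_iff_ne_zero.2 hb
  · rfl

theorem varDiv_comm (a b : V) (p : MvPolynomial V k) :
    varDiv k a (varDiv k b p) = varDiv k b (varDiv k a p) := by
  ext m
  simp only [coeff_varDiv]
  rw [add_left_comm]

theorem isHomogeneous_varDiv (a : V) {p : MvPolynomial V k} {q : ℕ}
    (hp : p.IsHomogeneous (q + 1)) : (varDiv k a p).IsHomogeneous q := by
  intro m hm
  rw [coeff_varDiv] at hm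
  have := hp hm
  rw [map_add, Finsupp.weight_single] at this
  simp at this
  omega

theorem varDiv_eq_zero (a : V) {p : MvPolynomial V k} (hp : p.IsHomogeneous 0) :
    varDiv k a p = 0 := by
  ext m
  rw [coeff_varDiv, coeff_zero]
  by_contra hm
  have := hp hm
  rw [map_add, Finsupp.weight_single] at this
  simp at this

theorem eq_zero_of_varDiv_eq_zero {p : MvPolynomial V k} (h : ∀ a, varDiv k a p = 0)
    (h0 : coeff 0 p = 0) : p = 0 := by
  ext m
  by_cases hm : m = 0
  · rw [hm, h0, coeff_zero]
  obtain ⟨a, ha⟩ := Finsupp.ne_iff.1 hm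
  have := congrArg (coeff (m - Finsupp.single a 1)) (h a)
  rwa [coeff_varDiv, add_tsub_cancel_of_le] at this
  rw [Finsupp.single_le_iff]
  exact Nat.one_le_iff_ne_zero.2 ha

theorem X_smul_mem_homogeneousSubmodule (q : ℕ) (a : V) {p : MvPolynomial V k}
    (hp : p ∈ homogeneousSubmodule V k q) :
    (X a : MvPolynomial V k) • p ∈ homogeneousSubmodule V k (q + 1) := by
  rw [add_comm]
  exact (isHomogeneous_X k a).mul hp

theorem X_smul_mem_freePiece {ι : Type*} (deg : ι → ℕ) (q : ℕ) (a : V)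
    {m : ι →₀ MvPolynomial V k} (hm : m ∈ freePiece (k := k) deg q) :
    (X a : MvPolynomial V k) • m ∈ freePiece (k := k) deg (q + 1) := by
  rw [add_comm]
  exact StandardResolution.isAct_free deg _ _ _ _ (isHomogeneous_X k a) hm

variable [LinearOrder V] [Fintype V]

theorem exists_koszulD_eq_ring {p q : ℕ} {z : Finset V → MvPolynomial V k}
    (hz : z ∈ koszulChains V p (homogeneousSubmodule V k (q + 1)))
    (hdz : koszulD (varMul k (MvPolynomial V k)) z = 0) :
    ∃ w ∈ koszulChains V (p + 1) (homogeneousSubmodule V k q),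
      koszulD (varMul k (MvPolynomial V k)) w = z := by
  refine exists_koszulD_eq (y := varDiv k) commute_varMul
    (fun a => ?_) (fun a b hab => ?_)
    (fun a b => ?_)
    (fun a m hm => X_smul_mem_homogeneousSubmodule q a hm)
    (fun a m hm => ?_) (lcoeff k 0) (fun a m => ?_)
    (fun m h h0 => ?_) hz hdz (fun hp => ?_)
  · refine LinearMap.ext fun m => ?_
    rw [Module.End.mul_apply, varMul_apply, smul_eq_mul, varDiv_X_mul_self, Module.End.one_apply]
  · refine LinearMap.ext fun m => ?_
    rw [Module.End.mul_apply, Module.End.mul_apply, varMul_apply, varMul_apply, smul_eq_mul,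
      smul_eq_mul, varDiv_X_mul hab]
  · refine LinearMap.ext fun m => ?_
    rw [Module.End.mul_apply, Module.End.mul_apply, varDiv_comm]
  · exact isHomogeneous_varDiv a hm
  · simp [varMul_apply, coeff_X_mul']
  · exact eq_zero_of_varDiv_eq_zero h h0
  · by_contra h
    have := (hz ∅).1 (by simp [hp]) h
    simp at this

/-- Unlike for the ring, a coordinate of degree `q + 1` may be a nonzero constant, namely when `deg
b = q + 1`; hence `h0`. -/
theorem exists_koszulD_eq_free {ι : Type*} {deg : ι → ℕ} {p q : ℕ}
    {z : Finset V → ι →₀ MvPolynomial V k}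
    (hz : z ∈ koszulChains V p (freePiece (k := k) deg (q + 1)))
    (hdz : koszulD (varMul k (ι →₀ MvPolynomial V k)) z = 0)
    (h0 : p = 0 → ∀ b, constantCoeff (z ∅ b) = 0) :
    ∃ w ∈ koszulChains V (p + 1) (freePiece (k := k) deg q),
      koszulD (varMul k (ι →₀ MvPolynomial V k)) w = z := by
  refine exists_koszulD_eq (y := fun a => Finsupp.mapRange.linearMap (varDiv k a)) commute_varMul
    (fun a => LinearMap.ext fun m => Finsupp.ext fun b => varDiv_X_mul_self a (m b))
    (fun a b hab => LinearMap.ext fun m => Finsupp.ext fun c => (varDiv_X_mul hab (m c)).symm)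
    (fun a b => LinearMap.ext fun m => Finsupp.ext fun c => varDiv_comm a b (m c))
    (fun a m hm => X_smul_mem_freePiece deg q a hm)
    (fun a m hm => ?_) (Finsupp.mapRange.linearMap (lcoeff k 0)) (fun a m => ?_)
    (fun m h h0 => ?_) hz hdz (fun hp => ?_)
  · intro b
    constructor
    · intro h
      refine isHomogeneous_varDiv a ?_
      have := (hm b).1 (by omega)
      rwa [Nat.sub_add_comm h] at this
    · intro h
      -- In the boundary case `deg b = q + 1` the coordinate is a constant, and division by a
      -- variable kills it.
      rcases Nat.lt_or_ge (q + 1) (deg b) with h' | h'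
      · simp [(hm b).2 h']
      · have := (hm b).1 h'
        rw [show q + 1 - deg b = 0 by omega] at this
        exact varDiv_eq_zero a this
  · ext b
    simp [varMul_apply, coeff_X_mul']
  · ext1 b
    exact eq_zero_of_varDiv_eq_zero (fun a => DFunLike.congr_fun (h a) b) (DFunLike.congr_fun h0 b)
  · ext b
    simpa [constantCoeff_eq] using h0 hp b

end FreeModule

/-! ### Homogeneous lifts and reduction modulo the variables -/

section Lift

variable {σ : Type u} {k : Type v} [Field k]

/-- A homogeneous element of the image of a graded map is the image of a homogeneous element. -/
theorem exists_mem_freePiece_of_mem_range {ι : Type*} {deg : ι → ℕ} {M : Type*} [AddCommGroup M]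
    [Module k M] [Module (MvPolynomial σ k) M] {gr : ℕ → Submodule k M} (hgr : iSupIndep gr)
    {f : (ι →₀ MvPolynomial σ k) →ₗ[MvPolynomial σ k] M}
    (hf : ∀ j, ∀ v ∈ freePiece (k := k) deg j, f v ∈ gr j) {q : ℕ} {z : M} (hz : z ∈ gr q)
    (hr : z ∈ LinearMap.range f) : ∃ v ∈ freePiece (k := k) deg q, f v = z := by
  obtain ⟨v, rfl⟩ := hr
  obtain ⟨c, hc, rfl⟩ := (Submodule.mem_iSup_iff_exists_finsupp _ v).1
    ((StandardResolution.iSup_freePiece (k := k) deg).symm ▸ Submodule.mem_top :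
      v ∈ ⨆ j, freePiece (k := k) deg j)
  set z := f (c.sum fun _ m => m) with hzdef
  refine ⟨c q, hc q, ?_⟩
  -- The images `f (c j)` sum to `z`, which sits in degree `q`. Subtracting `z` in degree `q` gives
  -- a vanishing sum of homogeneous terms; `q` is inserted because `c q` may be zero.
  have h := (iSupIndep_iff_finsetSum_eq_zero_imp_eq_zero _).1 hgr (insert q c.support)
    (fun j => f (c j) - if j = q then z else 0) (fun j _ => ?_) ?_ q (Finset.mem_insert_self _ _)
  · simpa [sub_eq_zero] using h
  · refine Submodule.sub_mem _ (hf j _ (hc j)) ?_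
    split_ifs with hj
    · exact hj ▸ hz
    · exact Submodule.zero_mem _
  · rw [Finset.sum_sub_distrib, Finset.sum_ite_eq', if_pos (Finset.mem_insert_self _ _), hzdef,
      Finsupp.sum, map_sum, sub_eq_zero]
    refine (Finset.sum_subset (Finset.subset_insert _ _) fun j _ hj => ?_).symm
    rw [Finsupp.notMem_support_iff.1 hj, map_zero]

theorem mem_span_range_X_iff {p : MvPolynomial σ k} :
    p ∈ Ideal.span (Set.range (X : σ → MvPolynomial σ k)) ↔ constantCoeff p = 0 := by
  rw [← Set.image_univ, mem_ideal_span_X_image, constantCoeff_eq]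
  constructor
  · intro h
    by_contra h0
    obtain ⟨i, -, hi⟩ := h 0 (mem_support_iff.2 h0)
    exact hi rfl
  · intro h m hm
    have hm0 : m ≠ 0 := by
      rintro rfl
      exact mem_support_iff.1 hm h
    obtain ⟨i, hi⟩ := Finsupp.ne_iff.1 hm0
    exact ⟨i, Set.mem_univ i, hi⟩

namespace GradedFreeResolution

variable {I : Ideal (MvPolynomial σ k)}

theorem smul_one_residueModule (p : MvPolynomial σ k) :
    p • (1 : ResidueModule σ k) = Ideal.Quotient.mk _ p :=
  congrArg (Ideal.Quotient.mk _) (mul_one p)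

theorem toReduction_eq_zero_iff (F : GradedFreeResolution.{u, v, w} I) (i : ℕ)
    (v : F.ι i →₀ MvPolynomial σ k) :
    F.toReduction i v = 0 ↔ ∀ b, constantCoeff (v b) = 0 := by
  constructor
  · intro h b
    rw [← mem_span_range_X_iff, ← Ideal.Quotient.eq_zero_iff_mem, ← smul_one_residueModule]
    -- The projection to coordinate `b`, tensored with `k`, sends `v ⊗ 1` to the class of `v b`.
    exact (congrArg ((TensorProduct.lid (MvPolynomial σ k) (ResidueModule σ k)).toLinearMap ∘ₗ
      LinearMap.rTensor (ResidueModule σ k)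
        (Finsupp.lapply b : (F.ι i →₀ MvPolynomial σ k) →ₗ[MvPolynomial σ k] _)) h).trans
      (map_zero _)
  · intro h
    induction v using Finsupp.induction with
    | zero => exact map_zero _
    | single_add b p v hb _ ih =>
      have hp : constantCoeff p = 0 := by simpa [Finsupp.notMem_support_iff.1 hb] using h b
      rw [map_add, ih, add_zero]
      · change (Finsupp.single b p) ⊗ₜ[MvPolynomial σ k] (1 : ResidueModule σ k) = 0
        rw [← mul_one p, ← smul_eq_mul, ← Finsupp.smul_single, TensorProduct.smul_tmul,
          smul_one_residueModule,
            Ideal.Quotient.eq_zero_iff_mem.2 (mem_span_range_X_iff.2 hp),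
          TensorProduct.tmul_zero]
      · intro c
        have := h c
        by_cases hc : b = c
        · subst hc
          simp [Finsupp.notMem_support_iff.1 hb]
        · simpa [Finsupp.single_eq_of_ne' hc] using this

end GradedFreeResolution

end Lift

/-! ### Tor from a resolution equals Koszul homology -/

namespace GradedFreeResolution

variable {V : Type u} {k : Type v} [Field k] {I : Ideal (MvPolynomial V k)}

theorem map_ε_freePiece (F : GradedFreeResolution.{u, v, w} I) (q : ℕ) :
    (freePiece (k := k) (F.deg 0) q).map (F.ε.restrictScalars k) =
      I.restrictScalars k ⊓ homogeneousSubmodule V k q := by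
  ext z
  constructor
  · rintro ⟨v, hv, rfl⟩
    refine ⟨?_, F.ε_mem q v hv⟩
    have : F.ε v ∈ LinearMap.range F.ε := ⟨v, rfl⟩
    rwa [F.range_ε] at this
  · rintro ⟨hz, hq⟩
    obtain ⟨v, hv, rfl⟩ := exists_mem_freePiece_of_mem_range
      (DirectSum.Decomposition.isInternal (homogeneousSubmodule V k)).submodule_iSupIndep
      F.ε_mem hq (show z ∈ LinearMap.range F.ε by rwa [F.range_ε])
    exact ⟨v, hv, rfl⟩

theorem map_d_freePiece (F : GradedFreeResolution.{u, v, w} I) (i q : ℕ) {N : Type*}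
    [AddCommGroup N] [Module k N] [Module (MvPolynomial V k) N]
    [IsScalarTower k (MvPolynomial V k) N]
    {f : (F.ι i →₀ MvPolynomial V k) →ₗ[MvPolynomial V k] N} (hf : Function.Exact (F.d i) f) :
    (freePiece (k := k) (F.deg (i + 1)) q).map ((F.d i).restrictScalars k) =
      LinearMap.ker (f.restrictScalars k) ⊓ freePiece (k := k) (F.deg i) q := by
  ext z
  constructor
  · rintro ⟨v, hv, rfl⟩
    exact ⟨hf.apply_apply_eq_zero v, F.d_mem i q v hv⟩
  · rintro ⟨hz, hq⟩
    obtain ⟨v, hv, rfl⟩ := exists_mem_freePiece_of_mem_range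
      (StandardResolution.iSupIndep_freePiece (F.deg i)) (F.d_mem i) hq ((hf z).1 hz)
    exact ⟨v, hv, rfl⟩

variable [LinearOrder V]

theorem single_mem_koszulChains {M : Type*} [AddCommGroup M] [Module k M] {W : Submodule k M}
    {m : M} (hm : m ∈ W) :
    LinearMap.single k (fun _ : Finset V => M) ∅ m ∈ koszulChains V 0 W := by
  intro T
  constructor
  · intro h
    obtain rfl := Finset.card_eq_zero.1 h
    simpa using hm
  · intro h
    simp [Pi.single_eq_of_ne (show T ≠ ∅ from fun h' => h (by simp [h']))]

theorem eq_single_of_mem_koszulChains {M : Type*} [AddCommGroup M] [Module k M]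
    {W : Submodule k M} {z : Finset V → M} (hz : z ∈ koszulChains V 0 W) :
    z = LinearMap.single k (fun _ : Finset V => M) ∅ (z ∅) := by
  ext T
  by_cases h : T = ∅
  · subst h
    simp
  · rw [(hz T).2 (by simpa using h)]
    simp [Pi.single_eq_of_ne h]

variable [Fintype V]

theorem constantCoeff_koszulD {ι : Type*} (w : Finset V → ι →₀ MvPolynomial V k) (T : Finset V)
    (b : ι) : constantCoeff (koszulD (varMul k (ι →₀ MvPolynomial V k)) w T b) = 0 := by
  rw [koszulD_apply_apply, Finsupp.finsetSum_apply, map_sum]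
  refine Finset.sum_eq_zero fun a _ => ?_
  split_ifs <;> simp [varMul_apply]

/-- With `m` the ideal of the variables, both sides say that `v ∈ ker f + m F_i`: on the left `ker
f` appears as the image of `d`, and on the right a boundary from exterior degree 1 is an element of
`m f(F_i)`. -/
theorem toReduction_mem_boundaries_iff (F : GradedFreeResolution.{u, v, w} I) (i q : ℕ)
    {N : Type*} [AddCommGroup N] [Module k N] [Module (MvPolynomial V k) N]
    [IsScalarTower k (MvPolynomial V k) N]
    {f : (F.ι i →₀ MvPolynomial V k) →ₗ[MvPolynomial V k] N} (hf : Function.Exact (F.d i) f)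
    {v : F.ι i →₀ MvPolynomial V k} (hv : v ∈ freePiece (k := k) (F.deg i) (q + 1)) :
    F.toReduction i v ∈ F.boundaries i (q + 1) ↔
      LinearMap.single k (fun _ : Finset V => N) ∅ (f v) ∈
        (koszulChains V 1 ((freePiece (k := k) (F.deg i) q).map (f.restrictScalars k))).map
          (koszulD (varMul k N)) := by
  have hD := koszulD_compLeft (V := V) (f := f.restrictScalars k)
    (x := varMul k (F.ι i →₀ MvPolynomial V k)) (x' := varMul k N) (fun a m => f.map_smul _ m)
  have hs : ∀ m, (f.restrictScalars k).compLeft (Finset V)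
      (LinearMap.single k (fun _ : Finset V => _) ∅ m) =
        LinearMap.single k (fun _ : Finset V => N) ∅ (f m) := by
    intro m
    ext T
    by_cases hT : T = ∅
    · subst hT
      simp
    · simp [Pi.single_eq_of_ne hT]
  constructor
  · rintro ⟨_, ⟨u, hu, rfl⟩, h⟩
    have h' : F.toReduction i (v - F.d i u) = 0 := by
      rw [map_sub, sub_eq_zero]
      exact h.symm
    obtain ⟨w, hw, hw'⟩ := exists_koszulD_eq_free
      (single_mem_koszulChains (V := V) (Submodule.sub_mem _ hv (F.d_mem i _ u hu)))
      (koszulD_eq_zero _ (single_mem_koszulChains (V := V)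
        (Submodule.sub_mem _ hv (F.d_mem i _ u hu))))
      (fun _ b => by simpa using (F.toReduction_eq_zero_iff i _).1 h' b)
    refine ⟨(f.restrictScalars k).compLeft (Finset V) w, ?_, ?_⟩
    · rw [← map_koszulChains]
      exact ⟨w, hw, rfl⟩
    · rw [hD, hw', hs, map_sub, hf.apply_apply_eq_zero, sub_zero]
  · rw [← map_koszulChains]
    rintro ⟨_, ⟨w, hw, rfl⟩, h⟩
    rw [hD, ← hs] at h
    have hw0 := koszulD_mem (x := varMul k (F.ι i →₀ MvPolynomial V k))
      (W' := freePiece (k := k) (F.deg i) (q + 1))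
      (fun a m hm => X_smul_mem_freePiece (F.deg i) q a hm) hw
    have hk : v - koszulD (varMul k (F.ι i →₀ MvPolynomial V k)) w ∅ ∈
        LinearMap.ker (f.restrictScalars k) ⊓ freePiece (k := k) (F.deg i) (q + 1) := by
      refine ⟨?_, Submodule.sub_mem _ hv ((hw0 ∅).1 rfl)⟩
      have := congrFun h ∅
      simp only [LinearMap.compLeft_apply, Function.comp_apply, LinearMap.coe_single,
        Pi.single_eq_same] at this
      exact LinearMap.mem_ker.2 (by rw [map_sub, this, sub_self])
    rw [← F.map_d_freePiece i (q + 1) hf] at hk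
    obtain ⟨u, hu, hu'⟩ := hk
    refine ⟨F.toReduction (i + 1) u, ⟨u, hu, rfl⟩, ?_⟩
    change F.toReduction i (F.d i u) = F.toReduction i v
    rw [← sub_eq_zero, ← map_sub, toReduction_eq_zero_iff]
    intro b
    rw [show F.d i u = _ from hu']
    simp [constantCoeff_koszulD]

theorem nonempty_tor_zero_equiv (F : GradedFreeResolution.{u, v, w} I) (q : ℕ) :
    Nonempty (F.Tor 0 (q + 1) ≃ₗ[k] KoszulHomology (V := V) (varMul k (MvPolynomial V k))
      (fun q => (freePiece (k := k) (F.deg 0) q).map (F.ε.restrictScalars k)) 0 q) := by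
  refine nonempty_subquotient_equiv (f := (F.toReduction 0).restrictScalars k)
    (g := LinearMap.single k (fun _ : Finset V => MvPolynomial V k) ∅ ∘ₗ F.ε.restrictScalars k)
    (A := freePiece (k := k) (F.deg 0) (q + 1)) rfl ?_
    (fun v hv => F.toReduction_mem_boundaries_iff 0 q F.exact_zero hv)
  ext z
  constructor
  · rintro ⟨v, hv, rfl⟩
    have h := single_mem_koszulChains (V := V) (Submodule.mem_map_of_mem
      (f := F.ε.restrictScalars k) hv)
    exact ⟨h, koszulD_eq_zero _ h⟩
  · rintro ⟨hz, -⟩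
    obtain ⟨v, hv, hv'⟩ := (hz ∅).1 rfl
    refine ⟨v, hv, ?_⟩
    rw [eq_single_of_mem_koszulChains hz, ← hv']
    rfl

theorem exists_koszulD_eq_freePiece {ι : Type*} (deg : ι → ℕ) (p q : ℕ)
    (z : Finset V → ι →₀ MvPolynomial V k)
    (hz : z ∈ koszulChains V (p + 1) (freePiece (k := k) deg (q + 1)))
    (hdz : koszulD (varMul k (ι →₀ MvPolynomial V k)) z = 0) :
    ∃ w ∈ koszulChains V (p + 2) (freePiece (k := k) deg q),
      koszulD (varMul k (ι →₀ MvPolynomial V k)) w = z :=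
  exists_koszulD_eq_free hz hdz fun h => absurd h (Nat.succ_ne_zero p)

/-- This is `nonempty_shift_equiv` at `p = 0`, where being a boundary is a genuine condition: `d v`
is one exactly when it lies in `m F_i`, that is, when `v ⊗ 1` is a cycle in `F_{i+1} ⊗ k`. -/
theorem nonempty_tor_succ_equiv (F : GradedFreeResolution.{u, v, w} I) (i q : ℕ) {N : Type*}
    [AddCommGroup N] [Module k N] [Module (MvPolynomial V k) N]
    [IsScalarTower k (MvPolynomial V k) N]
    {f : (F.ι i →₀ MvPolynomial V k) →ₗ[MvPolynomial V k] N} (hf : Function.Exact (F.d i) f) :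
    Nonempty (F.Tor (i + 1) (q + 2) ≃ₗ[k] KoszulHomology (V := V) (varMul k N)
      (fun q => (freePiece (k := k) (F.deg i) q).map (f.restrictScalars k)) 1 q) := by
  obtain ⟨e⟩ := nonempty_shift_equiv (f := f.restrictScalars k) (x' := varMul k N)
    (commute_varMul (k := k) (V := V)) (fun a m => f.map_smul _ m)
    (W := freePiece (k := k) (F.deg i))
    (fun q a m hm => X_smul_mem_freePiece (F.deg i) q a hm)
    (exists_koszulD_eq_freePiece (F.deg i)) (fun q => F.map_d_freePiece i q hf) 0 q
  suffices h : Nonempty (F.Tor (i + 1) (q + 2) ≃ₗ[k] _) from ⟨h.some.trans e.symm⟩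
  refine nonempty_subquotient_equiv (f := (F.toReduction (i + 1)).restrictScalars k)
    (g := LinearMap.single k (fun _ : Finset V => F.ι i →₀ MvPolynomial V k) ∅ ∘ₗ
      (F.d i).restrictScalars k)
    (A := freePiece (k := k) (F.deg (i + 1)) (q + 2) ⊓
      LinearMap.ker ((F.toReduction i ∘ₗ F.d i).restrictScalars k)) ?_ ?_
    (fun v hv => F.toReduction_mem_boundaries_iff (i + 1) (q + 1) (F.exact_succ i) hv.1)
  · ext z
    constructor
    · rintro ⟨v, ⟨hv, hv'⟩, rfl⟩
      exact ⟨⟨v, hv, rfl⟩, hv'⟩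
    · rintro ⟨⟨v, hv, rfl⟩, hv'⟩
      exact ⟨v, ⟨hv, hv'⟩, rfl⟩
  · ext z
    constructor
    · rintro ⟨v, ⟨hv, hv'⟩, rfl⟩
      have h1 := single_mem_koszulChains (V := V) (Submodule.mem_map_of_mem
        (f := (F.d i).restrictScalars k) hv)
      have h2 := single_mem_koszulChains (V := V) (F.d_mem i _ v hv)
      obtain ⟨w, hw, hw'⟩ := exists_koszulD_eq_free h2 (koszulD_eq_zero _ h2)
        (fun _ b => by simpa using (F.toReduction_eq_zero_iff i _).1 hv' b)
      exact ⟨h1, w, hw, hw'⟩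
    · rintro ⟨hz, w, hw, rfl⟩
      obtain ⟨v, hv, hv'⟩ := (hz ∅).1 rfl
      refine ⟨v, ⟨hv, ?_⟩, ?_⟩
      · change F.toReduction i (F.d i v) = 0
        rw [toReduction_eq_zero_iff, show F.d i v = _ from hv']
        exact constantCoeff_koszulD w ∅
      · rw [eq_single_of_mem_koszulChains hz, ← hv']
        rfl

theorem nonempty_koszulHomology_d_equiv (F : GradedFreeResolution.{u, v, w} I) (i q : ℕ)
    {N : Type*} [AddCommGroup N] [Module k N] [Module (MvPolynomial V k) N]
    [IsScalarTower k (MvPolynomial V k) N]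
    {f : (F.ι i →₀ MvPolynomial V k) →ₗ[MvPolynomial V k] N} (hf : Function.Exact (F.d i) f)
    (p : ℕ) :
    Nonempty (KoszulHomology (V := V) (varMul k (F.ι i →₀ MvPolynomial V k))
      (fun q => (freePiece (k := k) (F.deg (i + 1)) q).map ((F.d i).restrictScalars k))
        (p + 1) (q + 1) ≃ₗ[k] KoszulHomology (V := V) (varMul k N)
      (fun q => (freePiece (k := k) (F.deg i) q).map (f.restrictScalars k)) (p + 2) q) := by
  obtain ⟨e⟩ := nonempty_koszulHomology_shift (f := f.restrictScalars k) (x' := varMul k N)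
    (commute_varMul (k := k) (V := V)) (fun a m => f.map_smul _ m)
    (W := freePiece (k := k) (F.deg i))
    (fun q a m hm => X_smul_mem_freePiece (F.deg i) q a hm)
    (exists_koszulD_eq_freePiece (F.deg i)) (fun q => F.map_d_freePiece i q hf) p q
  exact ⟨e.symm⟩

/-- Each step down the resolution raises the exterior degree by one and lowers the coefficient
degree by one, keeping the total degree. -/
theorem nonempty_koszulHomology_equiv (F : GradedFreeResolution.{u, v, w} I) (i : ℕ) :
    ∀ p q : ℕ, Nonempty (KoszulHomology (V := V) (varMul k (F.ι i →₀ MvPolynomial V k))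
      (fun q => (freePiece (k := k) (F.deg (i + 1)) q).map ((F.d i).restrictScalars k))
        (p + 1) (q + i + 1) ≃ₗ[k] KoszulHomology (V := V) (varMul k (MvPolynomial V k))
      (fun q => (freePiece (k := k) (F.deg 0) q).map (F.ε.restrictScalars k)) (p + i + 2) q) := by
  induction i with
  | zero => exact fun p q => F.nonempty_koszulHomology_d_equiv 0 q F.exact_zero p
  | succ i ih =>
    intro p q
    obtain ⟨e⟩ := F.nonempty_koszulHomology_d_equiv (i + 1) (q + i + 1) (F.exact_succ i) p
    obtain ⟨e'⟩ := ih (p + 1) q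
    rw [show p + 1 + i + 2 = p + (i + 1) + 2 by omega] at e'
    exact ⟨e.trans e'⟩

/-- `Tor` computed from a free resolution agrees with the Koszul homology of the ideal. -/
theorem nonempty_tor_equiv (F : GradedFreeResolution.{u, v, w} I) (i q : ℕ) :
    Nonempty (F.Tor i (q + i + 1) ≃ₗ[k] KoszulHomology (V := V) (varMul k (MvPolynomial V k))
      (fun q => I.restrictScalars k ⊓ homogeneousSubmodule V k q) i q) := by
  have h : (fun q => I.restrictScalars k ⊓ homogeneousSubmodule V k q) =
      fun q => (freePiece (k := k) (F.deg 0) q).map (F.ε.restrictScalars k) :=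
    funext fun q => (F.map_ε_freePiece q).symm
  rw [h]
  -- For `i = 1` the comparison already ends at the image of `ε`; from `i = 2` on, the syzygy module
  -- has to be shifted down to `I`.
  match i with
  | 0 => exact F.nonempty_tor_zero_equiv q
  | 1 => exact F.nonempty_tor_succ_equiv 0 q F.exact_zero
  | i + 2 =>
    obtain ⟨e⟩ := F.nonempty_tor_succ_equiv (i + 1) (q + i + 1) (F.exact_succ i)
    obtain ⟨e'⟩ := F.nonempty_koszulHomology_equiv i 0 q
    rw [show 0 + i + 2 = i + 2 by omega] at e'
    exact ⟨e.trans e'⟩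

end GradedFreeResolution

/-! ### Low-degree coefficients of elements of the edge ideal -/

section EdgeIdeal

variable {V : Type u} {k : Type v} [Field k] {G : SimpleGraph V}

theorem mem_edgeIdeal_iff {p : MvPolynomial V k} :
    p ∈ edgeIdeal k G ↔ ∀ m ∈ p.support, ∃ s t, G.Adj s t ∧
      Finsupp.single s 1 + Finsupp.single t 1 ≤ m := by
  have h : {p : MvPolynomial V k | ∃ s t, G.Adj s t ∧ p = X s * X t} =
      (fun m => monomial m (1 : k)) ''
        {m | ∃ s t, G.Adj s t ∧ m = Finsupp.single s 1 + Finsupp.single t 1} := by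
    ext p
    constructor
    · rintro ⟨s, t, hst, rfl⟩
      exact ⟨_, ⟨s, t, hst, rfl⟩, by simp [X, monomial_mul]⟩
    · rintro ⟨_, ⟨s, t, hst, rfl⟩, rfl⟩
      exact ⟨s, t, hst, by simp [X, monomial_mul]⟩
  rw [edgeIdeal, h, mem_ideal_span_monomial_image]
  refine forall₂_congr fun m _ => ?_
  constructor
  · rintro ⟨_, ⟨s, t, hst, rfl⟩, hm⟩
    exact ⟨s, t, hst, hm⟩
  · rintro ⟨s, t, hst, hm⟩
    exact ⟨_, ⟨s, t, hst, rfl⟩, hm⟩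

theorem coeff_eq_zero_of_mem_edgeIdeal {p : MvPolynomial V k} (hp : p ∈ edgeIdeal k G) {a b : V}
    (hab : ¬ G.Adj a b) : coeff (Finsupp.single a 1 + Finsupp.single b 1) p = 0 := by
  classical
  by_contra h
  obtain ⟨s, t, hst, hle⟩ := mem_edgeIdeal_iff.1 hp _ (mem_support_iff.2 h)
  have hs := hle s
  have ht := hle t
  simp only [Finsupp.add_apply, Finsupp.single_apply, if_true, hst.ne, hst.ne'] at hs ht
  have hs' : a = s ∨ b = s := by
    by_contra! h
    simp [h.1, h.2] at hs
  have ht' : a = t ∨ b = t := by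
    by_contra! h
    simp [h.1, h.2] at ht
  rcases hs' with rfl | rfl <;> rcases ht' with rfl | rfl
  · exact hst.ne rfl
  · exact hab hst
  · exact hab hst.symm
  · exact hst.ne rfl

/-- Generators have degree 2. This removes all boundaries in the linear strand. -/
theorem edgeIdeal_inf_homogeneousSubmodule_one :
    (edgeIdeal k G).restrictScalars k ⊓ homogeneousSubmodule V k 1 = ⊥ := by
  rw [eq_bot_iff]
  rintro p ⟨hp, hp1⟩
  rw [Submodule.mem_bot, ← support_eq_empty, Finset.eq_empty_iff_forall_notMem]
  intro m hm
  obtain ⟨s, t, -, hle⟩ := mem_edgeIdeal_iff.1 hp m hm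
  obtain ⟨r, rfl⟩ := exists_add_of_le hle
  have := hp1 (mem_support_iff.1 hm)
  rw [map_add, map_add, Finsupp.weight_single, Finsupp.weight_single] at this
  simp at this
  omega

theorem X_mul_X_mem_edgeIdeal {a b : V} (h : G.Adj a b) :
    (X a * X b : MvPolynomial V k) ∈ edgeIdeal k G :=
  Ideal.subset_span ⟨a, b, h, rfl⟩

end EdgeIdeal

/-! ### Koszul chains with linear coefficients -/

section LinearChain

variable {V : Type u} [LinearOrder V] {k : Type v} [Field k]

theorem eq_sum_coeff_of_isHomogeneous_one [Fintype V] {p : MvPolynomial V k}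
    (hp : p.IsHomogeneous 1) : p = ∑ b, coeff (Finsupp.single b 1) p • X b := by
  ext m
  simp only [coeff_sum, coeff_smul, coeff_X, smul_eq_mul, mul_ite, mul_one, mul_zero]
  by_cases hm : ∃ b, Finsupp.single b 1 = m
  · obtain ⟨b, rfl⟩ := hm
    rw [Finset.sum_eq_single_of_mem b (Finset.mem_univ b)]
    · simp
    · intro c _ hc
      rw [if_neg]
      intro h
      exact hc (Finsupp.single_left_injective one_ne_zero h)
  · rw [Finset.sum_eq_zero fun b _ => if_neg fun h => hm ⟨b, h⟩]
    by_contra h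
    refine hm ?_
    have hd := hp h
    have hm0 : m ≠ 0 := by
      rintro rfl
      simp at hd
    obtain ⟨b, hb⟩ := Finsupp.ne_iff.1 hm0
    obtain ⟨r, rfl⟩ := exists_add_of_le
      (Finsupp.single_le_iff.2 (Nat.one_le_iff_ne_zero.2 hb) : Finsupp.single b 1 ≤ m)
    rw [map_add, Finsupp.weight_single] at hd
    have hr : Finsupp.degree r = 0 := by
      rw [Finsupp.degree_eq_weight_one]
      change Finsupp.weight 1 r = 0
      simpa using hd
    exact ⟨b, by rw [(Finsupp.degree_eq_zero_iff r).1 hr, add_zero]⟩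

theorem cast_koszulSign_swap {a b : V} {T : Finset V} (hab : a ≠ b) (ha : a ∉ T) (hb : b ∉ T) :
    (koszulSign a T : k) * koszulSign b (insert a T) =
      -(koszulSign b T * koszulSign a (insert b T)) := by
  exact_mod_cast congrArg (Int.cast (R := k)) (koszulSign_swap hab ha hb)

theorem cast_koszulSign_ne_zero (a : V) (T : Finset V) : (koszulSign a T : k) ≠ 0 := by
  have : (koszulSign a T : k) * koszulSign a T = 1 := by
    exact_mod_cast congrArg (Int.cast (R := k)) (koszulSign_mul_self a T)
  exact left_ne_zero_of_mul_eq_one this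

variable [Fintype V]

theorem koszulD_varMul_apply (w : Finset V → MvPolynomial V k) (U : Finset V) :
    koszulD (varMul k (MvPolynomial V k)) w U =
      ∑ a, if a ∈ U then 0 else koszulSign a U • (X a * w (insert a U)) := by
  rw [koszulD_apply_apply]
  rfl

theorem coeff_koszulD (w : Finset V → MvPolynomial V k) (U : Finset V) (m : V →₀ ℕ) :
    coeff m (koszulD (varMul k (MvPolynomial V k)) w U) =
      ∑ c, if c ∈ U then 0 else if m c = 0 then 0 else
        (koszulSign c U : k) * coeff (m - Finsupp.single c 1) (w (insert c U)) := by
  rw [koszulD_varMul_apply, coeff_sum]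
  refine Finset.sum_congr rfl fun c _ => ?_
  by_cases hc : c ∈ U
  · simp [hc]
  · rw [if_neg hc, if_neg hc, ← lcoeff_apply (R := k), map_zsmul, lcoeff_apply, coeff_X_mul',
      zsmul_eq_mul]
    by_cases hm : m c = 0 <;> simp [hm]

theorem coeff_koszulD_of_ne (w : Finset V → MvPolynomial V k) {U : Finset V} {a b : V}
    (hab : a ≠ b) (ha : a ∉ U) (hb : b ∉ U) :
    coeff (Finsupp.single a 1 + Finsupp.single b 1) (koszulD (varMul k (MvPolynomial V k)) w U) =
      koszulSign a U * coeff (Finsupp.single b 1) (w (insert a U)) +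
      koszulSign b U * coeff (Finsupp.single a 1) (w (insert b U)) := by
  rw [coeff_koszulD, Finset.sum_eq_add a b hab]
  · rw [if_neg ha, if_neg hb, if_neg (by simp), if_neg (by simp), add_tsub_cancel_left,
      add_tsub_cancel_right]
  · rintro c - ⟨hca, hcb⟩
    simp [Finsupp.single_eq_of_ne hca, Finsupp.single_eq_of_ne hcb]
  · simp
  · simp

theorem coeff_koszulD_self (w : Finset V → MvPolynomial V k) {U : Finset V} {a : V} (ha : a ∉ U) :
    coeff (Finsupp.single a 1 + Finsupp.single a 1) (koszulD (varMul k (MvPolynomial V k)) w U) =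
      koszulSign a U * coeff (Finsupp.single a 1) (w (insert a U)) := by
  rw [coeff_koszulD, Finset.sum_eq_single_of_mem a (Finset.mem_univ a)]
  · rw [if_neg ha, if_neg (by simp), add_tsub_cancel_left]
  · intro c _ hca
    simp [Finsupp.single_eq_of_ne hca]

/-- The Koszul chain of exterior degree `p` with linear coefficients whose component at `T`, up to
signs, is the sum of the `g (insert b T) b • X b`. -/
def linearChain (V : Type u) [LinearOrder V] [Fintype V] (k : Type v) [Field k] (p : ℕ) :
    (Finset V → V → k) →ₗ[k] (Finset V → MvPolynomial V k) where
  toFun g T := if T.card = p then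
    ∑ b, if b ∈ T then 0 else ((koszulSign b T : k) * g (insert b T) b) • X b else 0
  map_add' g h := by
    ext1 T
    by_cases hT : T.card = p
    · simp only [hT, if_true, Pi.add_apply, ← Finset.sum_add_distrib]
      refine Finset.sum_congr rfl fun b _ => ?_
      split_ifs
      · simp
      · rw [mul_add, add_smul]
    · simp [hT]
  map_smul' c g := by
    ext1 T
    by_cases hT : T.card = p
    · simp only [hT, if_true, Pi.smul_apply, Finset.smul_sum, RingHom.id_apply]
      refine Finset.sum_congr rfl fun b _ => ?_
      split_ifs
      · simp
      · rw [smul_smul, smul_eq_mul, mul_left_comm]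
    · simp [hT]

theorem linearChain_apply (p : ℕ) (g : Finset V → V → k) (T : Finset V) :
    linearChain V k p g T = if T.card = p then
      ∑ b, if b ∈ T then 0 else ((koszulSign b T : k) * g (insert b T) b) • X b else 0 := rfl

theorem linearChain_mem (p : ℕ) (g : Finset V → V → k) :
    linearChain V k p g ∈ koszulChains V p (homogeneousSubmodule V k 1) := by
  intro T
  rw [linearChain_apply]
  refine ⟨fun h => ?_, fun h => if_neg h⟩
  rw [if_pos h]
  refine Submodule.sum_mem _ fun b _ => ?_
  split_ifs
  · exact Submodule.zero_mem _
  · exact Submodule.smul_mem _ _ (isHomogeneous_X k b)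

theorem coeff_linearChain {p : ℕ} (g : Finset V → V → k) {T : Finset V} (hT : T.card = p) {b : V}
    (hb : b ∉ T) : coeff (Finsupp.single b 1) (linearChain V k p g T) =
      koszulSign b T * g (insert b T) b := by
  rw [linearChain_apply, if_pos hT, coeff_sum, Finset.sum_eq_single_of_mem b (Finset.mem_univ b)]
  · rw [if_neg hb, coeff_smul, coeff_X, if_pos rfl, smul_eq_mul, mul_one]
  · intro c _ hc
    split_ifs
    · simp
    · rw [coeff_smul, coeff_X, if_neg, smul_zero]
      intro h
      exact hc (Finsupp.single_left_injective one_ne_zero h)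

/-- The signs built into `linearChain` make the two ways of producing `X a * X b` carry opposite
signs, so a difference of values of `g` at the same set appears. -/
theorem coeff_koszulD_linearChain {p : ℕ} (g : Finset V → V → k) {U : Finset V} (hU : U.card = p)
    {a b : V} (hab : a ≠ b) (ha : a ∉ U) (hb : b ∉ U) :
    coeff (Finsupp.single a 1 + Finsupp.single b 1)
      (koszulD (varMul k (MvPolynomial V k)) (linearChain V k (p + 1) g) U) =
      koszulSign a U * koszulSign b (insert a U) *
        (g (insert a (insert b U)) b - g (insert a (insert b U)) a) := by
  rw [coeff_koszulD_of_ne _ hab ha hb,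
    coeff_linearChain g (by rw [Finset.card_insert_of_notMem ha, hU]) (by simp [hab.symm, hb]),
    coeff_linearChain g (by rw [Finset.card_insert_of_notMem hb, hU]) (by simp [hab, ha]),
    Finset.insert_comm b a]
  linear_combination (g (insert a (insert b U)) a) * (cast_koszulSign_swap (k := k) hab ha hb)

/-- Modulo `J` the terms for `(a, b)` and `(b, a)` cancel. The edge ideal as `J` serves to produce
syzygies, and `J = ⊥` to show that some of them vanish. -/
theorem koszulD_linearChain_mem {p : ℕ} {g : Finset V → V → k} {J : Ideal (MvPolynomial V k)}
    (hg : ∀ S : Finset V, S.card = p + 2 → ∀ a ∈ S, ∀ b ∈ S, a ≠ b →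
      (X a * X b : MvPolynomial V k) ∈ J ∨ g S a = g S b) {U : Finset V} (hU : U.card = p) :
    koszulD (varMul k (MvPolynomial V k)) (linearChain V k (p + 1) g) U ∈ J := by
  rw [← Ideal.Quotient.eq_zero_iff_mem]
  have h : koszulD (varMul k (MvPolynomial V k)) (linearChain V k (p + 1) g) U =
      ∑ a, ∑ b, if a ∈ U ∨ b ∈ insert a U then 0 else
        ((koszulSign a U : k) * koszulSign b (insert a U) * g (insert b (insert a U)) b) •
          (X a * X b) := by
    rw [koszulD_varMul_apply]
    refine Finset.sum_congr rfl fun a _ => ?_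
    by_cases ha : a ∈ U
    · simp [ha]
    · rw [if_neg ha, linearChain_apply,
        if_pos (by rw [Finset.card_insert_of_notMem ha, hU]), Finset.mul_sum, Finset.smul_sum]
      refine Finset.sum_congr rfl fun b _ => ?_
      by_cases hb : b ∈ insert a U
      · simp only [hb, if_true, mul_zero, smul_zero, or_true]
      · simp only [hb, if_false, ha, or_self]
        rw [mul_smul_comm, ← Int.cast_smul_eq_zsmul k, smul_smul, mul_assoc]
  rw [h, map_sum]
  simp only [map_sum]
  refine sum_sum_eq_zero_of_swap (fun a => by simp) fun a b hab => ?_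
  rw [← map_add, Ideal.Quotient.eq_zero_iff_mem]
  by_cases ha : a ∈ U
  · simp [ha]
  by_cases hb : b ∈ U
  · simp [hb]
  simp only [ha, hb, hab, hab.symm, Finset.mem_insert, or_self, if_false]
  rw [mul_comm (X b) (X a), ← add_smul, Finset.insert_comm b a]
  rcases hg (insert a (insert b U)) (by
    rw [Finset.card_insert_of_notMem (by simp [hab, ha]), Finset.card_insert_of_notMem hb, hU])
    a (by simp) b (by simp) hab with h | h
  · exact Submodule.smul_of_tower_mem J _ h
  · rw [h, ← add_mul, cast_koszulSign_swap hab ha hb, neg_add_cancel, zero_mul, zero_smul]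
    exact J.zero_mem

theorem exists_linearChain_eq {G : SimpleGraph V} {p : ℕ} {w : Finset V → MvPolynomial V k}
    (hw : w ∈ koszulChains V (p + 1) (homogeneousSubmodule V k 1))
    (hdw : ∀ U : Finset V, U.card = p →
      koszulD (varMul k (MvPolynomial V k)) w U ∈ edgeIdeal k G) :
    ∃ g : Finset V → V → k, linearChain V k (p + 1) g = w ∧
      ∀ S : Finset V, S.card = p + 2 → ∀ a ∈ S, ∀ b ∈ S, ¬ G.Adj a b → g S a = g S b := by
  -- Up to sign this is the coefficient of the square of `X b` in `∂w` at `T.erase b`; it vanishes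
  -- because `G` has no loops.
  have h0 : ∀ T : Finset V, T.card = p + 1 → ∀ b ∈ T, coeff (Finsupp.single b 1) (w T) = 0 := by
    intro T hT b hb
    have h := coeff_koszulD_self w (Finset.notMem_erase b T)
    rw [Finset.insert_erase hb, coeff_eq_zero_of_mem_edgeIdeal (hdw _ (by
      rw [Finset.card_erase_of_mem hb, hT, Nat.add_sub_cancel])) (G.loopless.irrefl b)] at h
    exact (mul_eq_zero.1 h.symm).resolve_left (cast_koszulSign_ne_zero _ _)
  -- Forced by `coeff_linearChain`, as each sign is its own inverse.
  let g : Finset V → V → k := fun S b =>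
    koszulSign b S * coeff (Finsupp.single b 1) (w (S.erase b))
  have hg : linearChain V k (p + 1) g = w := by
    ext1 T
    rw [linearChain_apply]
    by_cases hT : T.card = p + 1
    · rw [if_pos hT, eq_sum_coeff_of_isHomogeneous_one ((hw T).1 hT)]
      refine Finset.sum_congr rfl fun b _ => ?_
      by_cases hb : b ∈ T
      · rw [if_pos hb, h0 T hT b hb, zero_smul]
      · have h1 : (koszulSign b T : k) * koszulSign b T = 1 := by
          exact_mod_cast congrArg (Int.cast (R := k)) (koszulSign_mul_self b T)
        have h2 : g (insert b T) b = koszulSign b T * coeff (Finsupp.single b 1) (w T) := by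
          simp only [g, Finset.erase_insert hb, koszulSign_insert_self hb]
        rw [if_neg hb, h2, ← mul_assoc, h1, one_mul]
    · rw [if_neg hT, (hw T).2 hT]
  refine ⟨g, hg, fun S hS a ha b hb hab => ?_⟩
  by_cases hne : a = b
  · rw [hne]
  have hb' : b ∈ S.erase a := Finset.mem_erase.2 ⟨Ne.symm hne, hb⟩
  have hU : ((S.erase a).erase b).card = p := by
    rw [Finset.card_erase_of_mem hb', Finset.card_erase_of_mem ha, hS]
    rfl
  have h := coeff_koszulD_linearChain g hU hne (by simp) (by simp)
  rw [hg, coeff_eq_zero_of_mem_edgeIdeal (hdw _ hU) hab, Finset.insert_erase hb',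
    Finset.insert_erase ha] at h
  have h2 := (mul_eq_zero.1 h.symm).resolve_left
    (mul_ne_zero (cast_koszulSign_ne_zero _ _) (cast_koszulSign_ne_zero _ _))
  exact (sub_eq_zero.1 h2).symm

end LinearChain

/-! ### Counting components and the dimension of the linear strand -/

section Count

variable {V : Type u} (G : SimpleGraph V)

/-- The connected components of the complement of the induced subgraph on `S`. -/
abbrev ComplComponents (S : Finset V) : Type u :=
  ((G.induce (S : Set V))ᶜ).ConnectedComponent

variable {G} in
theorem eq_of_forall_not_adj {S : Finset V} {β : Type*} {g : V → β}
    (hg : ∀ a ∈ S, ∀ b ∈ S, ¬ G.Adj a b → g a = g b) {x y : (S : Set V)}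
    (p : (G.induce (S : Set V))ᶜ.Walk x y) : g x = g y := by
  induction p with
  | nil => rfl
  | cons h _ ih =>
    exact (hg _ (Subtype.property _) _ (Subtype.property _)
      ((SimpleGraph.compl_adj _ _ _).1 h).2).trans ih

variable [Fintype V] {k : Type v} [Field k]

/-- Functions that are constant on the components of each complement. -/
def constComponents (k : Type v) [Field k] (p : ℕ) :
    ((Finset.univ : Finset V).powersetCard p → k) →ₗ[k]
      (∀ S : (Finset.univ : Finset V).powersetCard p, ComplComponents G S.1 → k) where
  toFun c S _ := c S
  map_add' _ _ := rfl
  map_smul' _ _ := rfl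

/-- The cardinality `p + 1` makes every `S` nonempty, so it has a component on which to evaluate. -/
theorem constComponents_injective (p : ℕ) :
    Function.Injective (constComponents G k (p + 1)) := by
  intro c c' h
  ext S
  have hS : S.1.card = p + 1 := (Finset.mem_powersetCard.1 S.2).2
  obtain ⟨b, hb⟩ := Finset.card_pos.1 (by omega : 0 < S.1.card)
  exact congrFun (congrFun h S) (SimpleGraph.connectedComponentMk _ ⟨b, hb⟩)

variable [LinearOrder V]

/-- The function on pairs of a set `S` of cardinality `p` and an element of `S` that is determined
by values on the components of the complements. -/
def componentFun (k : Type v) [Field k] (p : ℕ) :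
    (∀ S : (Finset.univ : Finset V).powersetCard p, ComplComponents G S.1 → k) →ₗ[k]
      (Finset V → V → k) where
  toFun f S b := if h : S ∈ (Finset.univ : Finset V).powersetCard p ∧ b ∈ S then
    f ⟨S, h.1⟩ (SimpleGraph.connectedComponentMk _ ⟨b, h.2⟩) else 0
  map_add' f g := by
    ext S b
    by_cases h : S ∈ (Finset.univ : Finset V).powersetCard p ∧ b ∈ S
    · simp only [Pi.add_apply, dif_pos h]
    · simp only [Pi.add_apply, dif_neg h, add_zero]
  map_smul' c f := by
    ext S b
    by_cases h : S ∈ (Finset.univ : Finset V).powersetCard p ∧ b ∈ S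
    · simp only [Pi.smul_apply, RingHom.id_apply, dif_pos h]
    · simp only [Pi.smul_apply, RingHom.id_apply, dif_neg h, smul_zero]

theorem componentFun_apply {p : ℕ}
    (f : ∀ S : (Finset.univ : Finset V).powersetCard p, ComplComponents G S.1 → k)
    (S : (Finset.univ : Finset V).powersetCard p) {b : V} (hb : b ∈ S.1) :
    componentFun G k p f S.1 b = f S (SimpleGraph.connectedComponentMk _ ⟨b, hb⟩) :=
  dif_pos ⟨S.2, hb⟩

theorem componentFun_eq_of_not_adj {p : ℕ}
    (f : ∀ S : (Finset.univ : Finset V).powersetCard p, ComplComponents G S.1 → k)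
    {S : Finset V} (hS : S.card = p) {a b : V} (ha : a ∈ S) (hb : b ∈ S)
    (hab : ¬ G.Adj a b) : componentFun G k p f S a = componentFun G k p f S b := by
  have hS' : S ∈ (Finset.univ : Finset V).powersetCard p := by simpa using hS
  rw [componentFun_apply G f ⟨S, hS'⟩ ha, componentFun_apply G f ⟨S, hS'⟩ hb]
  by_cases hne : a = b
  · subst hne
    rfl
  · congr 1
    apply SimpleGraph.ConnectedComponent.sound
    apply SimpleGraph.Adj.reachable
    exact (SimpleGraph.compl_adj _ _ _).2 ⟨fun h => hne (congrArg Subtype.val h), hab⟩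

theorem exists_componentFun_eq {p : ℕ} {g : Finset V → V → k}
    (hg : ∀ S : Finset V, S.card = p → ∀ a ∈ S, ∀ b ∈ S, ¬ G.Adj a b → g S a = g S b) :
    ∃ f, ∀ S : Finset V, S.card = p → ∀ b ∈ S, componentFun G k p f S b = g S b := by
  refine ⟨fun S => SimpleGraph.ConnectedComponent.lift (fun x => g S.1 x) fun x y q _ =>
    eq_of_forall_not_adj (hg S.1 (Finset.mem_powersetCard.1 S.2).2) q, fun S hS b hb => ?_⟩
  have hS' : S ∈ (Finset.univ : Finset V).powersetCard p := by simpa using hS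
  rw [componentFun_apply G _ ⟨S, hS'⟩ hb]
  rfl

/-- The linear syzygy with given values on the components of the complements. -/
def componentSyzygy (k : Type v) [Field k] (i : ℕ) :
    (∀ S : (Finset.univ : Finset V).powersetCard (i + 2), ComplComponents G S.1 → k) →ₗ[k]
      (Finset V → MvPolynomial V k) :=
  koszulD (varMul k (MvPolynomial V k)) ∘ₗ linearChain V k (i + 1) ∘ₗ componentFun G k (i + 2)

theorem linearChain_congr {p : ℕ} {g h : Finset V → V → k}
    (hgh : ∀ S : Finset V, S.card = p + 1 → ∀ b ∈ S, g S b = h S b) :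
    linearChain V k p g = linearChain V k p h := by
  ext1 T
  rw [linearChain_apply, linearChain_apply]
  split_ifs with hT
  · refine Finset.sum_congr rfl fun b _ => ?_
    split_ifs with hb
    · rfl
    · rw [hgh _ (by rw [Finset.card_insert_of_notMem hb, hT]) b (by simp)]
  · rfl

theorem range_componentSyzygy (i : ℕ) :
    LinearMap.range (componentSyzygy G k i) =
      koszulChains V i ((edgeIdeal k G).restrictScalars k ⊓ homogeneousSubmodule V k 2) ⊓
        LinearMap.ker (koszulD (varMul k (MvPolynomial V k))) := by
  ext z
  constructor
  · rintro ⟨f, rfl⟩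
    refine ⟨fun U => ?_, koszulD_koszulD commute_varMul _⟩
    have hm := koszulD_mem (x := varMul k (MvPolynomial V k))
      (fun a m hm => X_smul_mem_homogeneousSubmodule 1 a hm)
      (linearChain_mem (i + 1) (componentFun G k (i + 2) f)) U
    refine ⟨fun hU => ⟨koszulD_linearChain_mem (fun S hS a ha b hb _ => ?_) hU, hm.1 hU⟩, hm.2⟩
    by_cases hab : G.Adj a b
    · exact Or.inl (X_mul_X_mem_edgeIdeal hab)
    · exact Or.inr (componentFun_eq_of_not_adj G f hS ha hb hab)
  · rintro ⟨hz, hdz⟩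
    have hz' : z ∈ koszulChains V i (homogeneousSubmodule V k (1 + 1)) :=
      fun T => ⟨fun hT => ((hz T).1 hT).2, (hz T).2⟩
    -- The primitive `w` exists over `R`, not over the edge ideal; that `∂w` has coefficients in the
    -- ideal is what constrains `w`.
    obtain ⟨w, hw, rfl⟩ := exists_koszulD_eq_ring hz' hdz
    obtain ⟨g, rfl, hg⟩ := exists_linearChain_eq hw fun U hU => ((hz U).1 hU).1
    obtain ⟨f, hf⟩ := exists_componentFun_eq G hg
    refine ⟨f, ?_⟩
    change koszulD _ (linearChain V k (i + 1) (componentFun G k (i + 2) f)) = _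
    rw [linearChain_congr hf]

/-- Vanishing of the coefficient of `X a * X b` for every pair in `S`, adjacent or not, forces the
same value on all components. -/
theorem ker_componentSyzygy (i : ℕ) :
    LinearMap.ker (componentSyzygy G k i) = LinearMap.range (constComponents G k (i + 2)) := by
  ext f
  constructor
  · intro h
    have key : ∀ S : (Finset.univ : Finset V).powersetCard (i + 2), ∃ c,
        ∀ K : ComplComponents G S.1, f S K = c := by
      intro S
      have hS : S.1.card = i + 2 := (Finset.mem_powersetCard.1 S.2).2
      obtain ⟨a, ha⟩ := Finset.card_pos.1 (by omega : 0 < S.1.card)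
      refine ⟨f S (SimpleGraph.connectedComponentMk _ ⟨a, ha⟩), fun K => ?_⟩
      induction K using SimpleGraph.ConnectedComponent.ind with
      | h x =>
        obtain ⟨b, hb⟩ := x
        have hb : b ∈ S.1 := hb
        rw [← componentFun_apply G f S ha, ← componentFun_apply G f S hb]
        by_cases hne : a = b
        · rw [hne]
        have hb' : b ∈ S.1.erase a := Finset.mem_erase.2 ⟨Ne.symm hne, hb⟩
        have hU : ((S.1.erase a).erase b).card = i := by
          rw [Finset.card_erase_of_mem hb', Finset.card_erase_of_mem ha, hS]
          rfl
        have h1 := coeff_koszulD_linearChain (componentFun G k (i + 2) f) hU hne (by simp)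
          (by simp)
        have h2 := congrArg (coeff (Finsupp.single a 1 + Finsupp.single b 1))
          (congrFun (LinearMap.mem_ker.1 h) ((S.1.erase a).erase b))
        rw [Pi.zero_apply, coeff_zero] at h2
        rw [Finset.insert_erase hb', Finset.insert_erase ha] at h1
        have h3 := (mul_eq_zero.1 (h1.symm.trans h2)).resolve_left
          (mul_ne_zero (cast_koszulSign_ne_zero _ _) (cast_koszulSign_ne_zero _ _))
        exact sub_eq_zero.1 h3
    choose c hc using key
    exact ⟨c, funext fun S => funext fun K => (hc S K).symm⟩
  · rintro ⟨c, rfl⟩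
    rw [LinearMap.mem_ker]
    ext1 U
    by_cases hU : U.card = i
    · rw [Pi.zero_apply, ← Submodule.mem_bot (R := MvPolynomial V k)]
      refine koszulD_linearChain_mem (fun S hS a ha b hb _ => Or.inr ?_) hU
      have hS' : S ∈ (Finset.univ : Finset V).powersetCard (i + 2) := by simpa using hS
      rw [componentFun_apply G _ ⟨S, hS'⟩ ha, componentFun_apply G _ ⟨S, hS'⟩ hb]
      rfl
    · exact (koszulD_mem (x := varMul k (MvPolynomial V k))
        (fun a m hm => X_smul_mem_homogeneousSubmodule 1 a hm)
        (linearChain_mem (i + 1) (componentFun G k (i + 2) _)) U).2 hU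

/-- Rank–nullity: the source has one dimension per component of each complement, the kernel one per
set `S`. -/
theorem finrank_range_componentSyzygy (i : ℕ) :
    (Module.finrank k (LinearMap.range (componentSyzygy G k i)) : ℤ) =
      ∑ S ∈ Finset.univ.powersetCard (i + 2), ((numCompCompl G S : ℤ) - 1) := by
  classical
  have h1 := LinearMap.finrank_range_add_finrank_ker (componentSyzygy G k i)
  rw [ker_componentSyzygy, LinearMap.finrank_range_of_inj (constComponents_injective G (i + 1)),
    Module.finrank_fintype_fun_eq_card, Module.finrank_pi_fintype, Fintype.card_coe] at h1
  have h2 : ∑ S : (Finset.univ : Finset V).powersetCard (i + 2),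
      Module.finrank k (ComplComponents G S.1 → k) =
        ∑ S ∈ (Finset.univ : Finset V).powersetCard (i + 2), numCompCompl G S := by
    rw [← Finset.sum_coe_sort _ (numCompCompl G)]
    refine Finset.sum_congr rfl fun S _ => ?_
    rw [Module.finrank_fintype_fun_eq_card, numCompCompl, Nat.card_eq_fintype_card]
  rw [h2] at h1
  rw [Finset.sum_sub_distrib, ← Nat.cast_sum, ← h1]
  simp

theorem nonempty_gradedTor_edgeIdeal_equiv (i : ℕ) :
    Nonempty (GradedTor (edgeIdeal k G) (edgeIdeal_isHomogeneous k G) i (i + 2) ≃ₗ[k]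
      LinearMap.range (componentSyzygy G k i)) := by
  -- The value `q = 1` selects coefficients in `I_2` for the cycles and in `I_1 = 0` for the
  -- boundaries.
  obtain ⟨e⟩ := (standardResolution (edgeIdeal k G)
    (edgeIdeal_isHomogeneous k G)).nonempty_tor_equiv i 1
  rw [show 1 + i + 1 = i + 2 by omega] at e
  have hbot : (koszulChains V (i + 1)
      ((edgeIdeal k G).restrictScalars k ⊓ homogeneousSubmodule V k 1)).map
        (koszulD (varMul k (MvPolynomial V k))) = ⊥ := by
    rw [edgeIdeal_inf_homogeneousSubmodule_one, eq_bot_iff, Submodule.map_le_iff_le_comap]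
    intro z hz
    have : z = 0 := by
      ext1 T
      by_cases hT : T.card = i + 1
      · exact (hz T).1 hT
      · exact (hz T).2 hT
    rw [this]
    exact Submodule.zero_mem _
  rw [range_componentSyzygy]
  obtain ⟨e'⟩ := nonempty_quotient_bot_equiv (koszulChains V i
    ((edgeIdeal k G).restrictScalars k ⊓ homogeneousSubmodule V k 2) ⊓
      LinearMap.ker (koszulD (varMul k (MvPolynomial V k))))
  rw [← hbot] at e'
  exact ⟨e.trans e'⟩

end Count

theorem finite_and_gradedBetti_eq {V : Type u} [Fintype V] (G : SimpleGraph V) (k : Type v)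
    [Field k] (i : ℕ) :
    Module.Finite k (GradedTor (edgeIdeal k G) (edgeIdeal_isHomogeneous k G) i (i + 2)) ∧
      (gradedBetti (edgeIdeal k G) (edgeIdeal_isHomogeneous k G) i (i + 2) : ℤ) =
        ∑ S ∈ Finset.univ.powersetCard (i + 2), ((numCompCompl G S : ℤ) - 1) := by
  -- An arbitrary order, used only for the Koszul signs; neither side of the formula involves it.
  let : LinearOrder V := LinearOrder.lift' (Fintype.equivFin V) (Fintype.equivFin V).injective
  obtain ⟨e⟩ := nonempty_gradedTor_edgeIdeal_equiv (k := k) G i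
  classical
  refine ⟨Module.Finite.equiv e.symm, ?_⟩
  rw [gradedBetti, e.finrank_eq, finrank_range_componentSyzygy]

end

theorem proposition2p1 {V : Type u} [Fintype V] (G : SimpleGraph V) :
    (∀ (k : Type v) [Field k] (i : ℕ),
      Module.Finite k (GradedTor (edgeIdeal k G) (edgeIdeal_isHomogeneous k G) i (i + 2)) ∧
      (gradedBetti (edgeIdeal k G) (edgeIdeal_isHomogeneous k G) i (i + 2) : ℤ) =
        ∑ S ∈ Finset.univ.powersetCard (i + 2), ((numCompCompl G S : ℤ) - 1)) ∧
    (∀ (k : Type v) [Field k] (k' : Type w) [Field k'] (i : ℕ),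
      gradedBetti (edgeIdeal k G) (edgeIdeal_isHomogeneous k G) i (i + 2) =
        gradedBetti (edgeIdeal k' G) (edgeIdeal_isHomogeneous k' G) i (i + 2)) := by
  refine ⟨fun k _ i => finite_and_gradedBetti_eq G k i, fun k _ k' _ i => ?_⟩
  have h := (finite_and_gradedBetti_eq G k i).2.trans (finite_and_gradedBetti_eq G k' i).2.symm
  exact_mod_cast h
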